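/- Let $X$ and $Y$ be random variables with joint law $\mu=P(X,Y)$, discrete or continuous (formally, $X$ takes values in a standard Borel space and $Y$ in a measurable space), and suppose that $X$ and $Y$ are not independent. *Definitions.* A representation $Z$ of $X$ is given by an encoder, i.e. a Markov kernel $p(z|x)$, so that $Z\leftarrow X\leftrightarrow Y$ is a Markov chain; put $\mathrm{IB}_\beta[p(z|x)]=I(X;Z)-\beta\, I(Y;Z)$ for $\beta\in\mathbb R$ whenever $I(X;Z)<\infty$. The pair $(X,Y)$ is $\mathrm{IB}_\beta$-learnable if some encoder with $I(X;Z)<\infty$ has a strictly smaller value of $\mathrm{IB}_\beta$ than the trivial encoders $p(z|x)=p(z)$. For $h\colon\mathcal X\to\mathbb R$ with $\mathbb E[h(X)^2]<\infty$ let $$\beta_0[h]=\frac{\mathbb E_{x\sim p(x)}[h(x)^2]-\left(\mathbb E_{x\sim p(x)}[h(x)]\right)^2}{\mathbb E_{y\sim p(y)}\left[\left(\mathbb E_{x\sim p(x|y)}[h(x)]\right)^2\right]-\left(\mathbb E_{x\sim p(x)}[h(x)]\right)^2}.$$ Call $h$ admissible if the denominator is positive, and let $\inf_h\beta_0[h]$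 be the infimum over all admissible $h$. Given a reference ($\sigma$-finite) measure $dz$ and a probability density $p(z)$ for which some event has probability strictly between $0$ and $1$, a perturbation of the trivial representation $p(z|x)=p(z)$ is a measurable function $h(z|x)$ with $\int h(z|x)\,dz=0$ for all $x$ such that $p(z)+\epsilon h(z|x)\ge 0$ for all $x,z$ and all real $\epsilon$ with $|\epsilon|$ small enough. Its second variation is $\delta^2\mathrm{IB}_\beta=\frac12\frac{d^2}{d\epsilon^2}\mathrm{IB}_\beta[p(z)+\epsilon h(z|x)]\big|_{\epsilon=0}$. The Pareto frontier is the function $r\mapsto\sup\{I(Y;Z): I(X;Z)\le r\}$, $r\ge 0$, the supremum being over all encoders. *Claim.* 1. Admissible $h$ exist, and $\beta_0[h]\ge 1$ for each of them. 2. If $\beta>\inf_h\beta_0[h]$, then $(X,Y)$ is $\mathrm{IB}_\beta$-learnable. 3. For every real $\beta$ and every $p(z)$ as above, the following are equivalent: (a) $\beta>\inf_h\beta_0[h]$; (b) there is a perturbation $h(z|x)$ whose second variation exists and is negative; (c) there is such a perturbation of the form $h(z|x)=h(x)h_2(z)$ with $h$ admissible, $\beta_0[h]<\beta$, $\int h_2(z)\,dz=0$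 and $\int h_2(z)^2/p(z)\,dz>0$. Moreover, every perturbation of the form described in (c), i.e. $h(x)h_2(z)$ with $h$ admissible, $\beta_0[h]<\beta$, $\int h_2(z)\,dz=0$ and $\int h_2(z)^2/p(z)\,dz>0$, has a negative second variation. 4. The Pareto frontier of $I(Y;Z)$ versus $I(X;Z)$ has a (right) slope at the origin, and $\left(\inf_h\beta_0[h]\right)^{-1}$ is a lower bound for this slope. -/

import Mathlib

open MeasureTheory ProbabilityTheory InformationTheory Filter Topology
open scoped ENNReal

namespace IB

/-- Mutual information (in nats) of a pair of random variables with joint law `ρ`. -/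
noncomputable def mutualInfo {A B : Type*} [MeasurableSpace A] [MeasurableSpace B]
    (ρ : Measure (A × B)) : ℝ≥0∞ :=
  klDiv ρ (ρ.fst.prod ρ.snd)

section Encoder

variable {X Y Z : Type*} [MeasurableSpace X] [MeasurableSpace Y] [MeasurableSpace Z]

/-- Joint law of `((X, Y), Z)` when `(X, Y)` has law `μ` and, given `(X, Y) = (x, y)`, the
representation `Z` has law `κ x = p(z|x)`; thus `Z ← X ↔ Y` is a Markov chain. -/
noncomputable def jointLaw (μ : Measure (X × Y)) (κ : Kernel X Z) : Measure ((X × Y) × Z) :=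
  μ ⊗ₘ (κ.comap Prod.fst measurable_fst)

/-- `I(X;Z)` for the representation given by the encoder `κ`. -/
noncomputable def infoXZ (μ : Measure (X × Y)) (κ : Kernel X Z) : ℝ≥0∞ :=
  mutualInfo ((jointLaw μ κ).map (fun w => (w.1.1, w.2)))

/-- `I(Y;Z)` for the representation given by the encoder `κ`. -/
noncomputable def infoYZ (μ : Measure (X × Y)) (κ : Kernel X Z) : ℝ≥0∞ :=
  mutualInfo ((jointLaw μ κ).map (fun w => (w.1.2, w.2)))

/-- The information bottleneck objective `I(X;Z) - β I(Y;Z)`. It is meaningful when `I(X;Z)` is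
finite; then `I(Y;Z)` is finite as well, by the Markov chain. -/
noncomputable def objective (μ : Measure (X × Y)) (β : ℝ) (κ : Kernel X Z) : ℝ :=
  (infoXZ μ κ).toReal - β * (infoYZ μ κ).toReal

end Encoder

section Learnability

variable {X Y : Type*} [MeasurableSpace X] [MeasurableSpace Y]

/-- `(X, Y)` with law `μ` is `IB_β`-learnable: some encoder, with finite `I(X;Z)`, has a strictly
smaller objective than the trivial encoders `p(z|x) = p(z)`. -/
def IsLearnable (μ : Measure (X × Y)) (β : ℝ) : Prop :=
  ∃ (Z : Type) (_ : MeasurableSpace Z) (_ : StandardBorelSpace Z) (κ : Kernel X Z),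
    IsMarkovKernel κ ∧ infoXZ μ κ ≠ ∞ ∧
      ∀ ν : Measure Z, IsProbabilityMeasure ν →
        objective μ β κ < objective μ β (Kernel.const X ν)

/-- The Pareto frontier of the information plane as a function: the largest value of `I(Y;Z)`
among the encoders with `I(X;Z) ≤ r` (for `r ≥ 0`). -/
noncomputable def paretoFrontier (μ : Measure (X × Y)) (r : ℝ) : ℝ :=
  sSup {t : ℝ | ∃ (Z : Type) (_ : MeasurableSpace Z) (_ : StandardBorelSpace Z) (κ : Kernel X Z),
    IsMarkovKernel κ ∧ infoXZ μ κ ≤ ENNReal.ofReal r ∧ t = (infoYZ μ κ).toReal}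

end Learnability

section BetaFunctional

variable {X Y : Type*} [MeasurableSpace X] [MeasurableSpace Y]

/-- `Var_{x ∼ p(x)}(h) = E_x[h²] - (E_x h)²`. -/
noncomputable def betaNum (μ : Measure (X × Y)) (h : X → ℝ) : ℝ :=
  (∫ x, h x ^ 2 ∂μ.fst) - (∫ x, h x ∂μ.fst) ^ 2

/-- `E_{y ∼ p(y)}[(E_{x ∼ p(x|y)} h)²] - (E_x h)²`; the kernel `p(x|y)` is the regular conditional
distribution of `X` given `Y`. -/
noncomputable def betaDen [StandardBorelSpace X] [Nonempty X]
    (μ : Measure (X × Y)) [IsFiniteMeasure μ] (h : X → ℝ) : ℝ :=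
  (∫ y, (∫ x, h x ∂((μ.map Prod.swap).condKernel y)) ^ 2 ∂μ.snd) - (∫ x, h x ∂μ.fst) ^ 2

/-- The functional `β₀[h]`. -/
noncomputable def betaZero [StandardBorelSpace X] [Nonempty X]
    (μ : Measure (X × Y)) [IsFiniteMeasure μ] (h : X → ℝ) : ℝ :=
  betaNum μ h / betaDen μ h

/-- The functions over which the infimum is taken: square integrable ones for which the
denominator of `β₀[h]` is positive. (It is never negative; where it vanishes, `β₀[h]` is
`+∞`, or `0/0` for constant `h`.) -/
def IsAdmissible [StandardBorelSpace X] [Nonempty X]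
    (μ : Measure (X × Y)) [IsFiniteMeasure μ] (h : X → ℝ) : Prop :=
  MemLp h 2 μ.fst ∧ 0 < betaDen μ h

/-- `inf_h β₀[h]`. -/
noncomputable def infBetaZero [StandardBorelSpace X] [Nonempty X]
    (μ : Measure (X × Y)) [IsFiniteMeasure μ] : ℝ :=
  sInf (betaZero μ '' {h | IsAdmissible μ h})

end BetaFunctional

section Variation

variable {X Y Z : Type*} [MeasurableSpace X] [MeasurableSpace Y] [MeasurableSpace Z]

/-- `p` is a probability density with respect to the reference measure `lam` (Lebesgue measure,
counting measure, ...), and it is not concentrated on an atom of the sigma-algebra: some event has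
probability strictly between `0` and `1`. It describes the trivial representation
`p(z|x) = p(z)`. -/
structure IsNondegenerateDensity (lam : Measure Z) (p : Z → ℝ) : Prop where
  measurable : Measurable p
  nonneg : ∀ z, 0 ≤ p z
  integral_eq_one : ∫ z, p z ∂lam = 1
  nondegenerate : ∃ A : Set Z, MeasurableSet A ∧ 0 < ∫ z in A, p z ∂lam ∧ ∫ z in A, p z ∂lam < 1

/-- `h = h(z|x)` is a perturbation function at the trivial representation `p`: it is measurable,
`∫ h(z|x) dz = 0`, and `p(z) + ε h(z|x)` is nonnegative, hence a conditional density, for all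
`ε` close to `0`. -/
structure IsPerturbation (lam : Measure Z) (p : Z → ℝ) (h : X → Z → ℝ) : Prop where
  measurable : Measurable (Function.uncurry h)
  integral_eq_zero : ∀ x, ∫ z, h x z ∂lam = 0
  nonneg : ∃ ε₀ : ℝ, 0 < ε₀ ∧ ∀ ε : ℝ, |ε| ≤ ε₀ → ∀ x z, 0 ≤ p z + ε * h x z

/-- The encoder with conditional density `p(z) + ε h(z|x)`. -/
noncomputable def perturbedEncoder (lam : Measure Z) [SFinite lam] (p : Z → ℝ) (h : X → Z → ℝ)
    (ε : ℝ) : Kernel X Z :=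
  (Kernel.const X lam).withDensity (fun x z => ENNReal.ofReal (p z + ε * h x z))

/-- `F` is twice differentiable at `0` with `F''(0) / 2 = v`, so that the second order term of the
expansion of `F ε` at `0` is `ε² v`. -/
def HasSecondOrderCoeff (F : ℝ → ℝ) (v : ℝ) : Prop :=
  ∃ F' : ℝ → ℝ, (∀ᶠ ε in 𝓝 (0 : ℝ), HasDerivAt F (F' ε) ε) ∧ HasDerivAt F' (2 * v) 0

/-- The second variation of `IB_β` at the trivial representation `p` in the direction `h`
exists and is negative. -/
def HasNegativeSecondVariation (μ : Measure (X × Y)) (β : ℝ) (lam : Measure Z) [SFinite lam]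
    (p : Z → ℝ) (h : X → Z → ℝ) : Prop :=
  ∃ v : ℝ, v < 0 ∧ HasSecondOrderCoeff (fun ε => objective μ β (perturbedEncoder lam p h ε)) v

end Variation

end IB

/-! Write `ν = p dz` and `G = h / p`, so that a perturbed encoder has density `1 + ε G` relative to
`ν`. Given `y`, the density of `Z` is `1 + ε` times the posterior mean of `G`. Since `klFun (1 + t)`
is `t² / 2` to second order, `I(X;Z)` is `ε² / 2` times the `ν`-average over `z` of the prior
variance of `G(·, z)`, and `I(Y;Z)` is the same with the variance of the posterior mean. These two
variances are `betaNum` and `betaDen`, so the second derivative of the objective at `0` is `∫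
(betaNum - β betaDen) dν` (`exists_expansion_objective`).

If `β ≤ inf β₀`, the integrand is nonnegative for each `z` (`infBetaZero_mul_betaDen_le`). If `β₀[h]
< β`, a product direction `h(x) h₂(z)` makes the integral a positive multiple of a negative number.
Truncation makes `h` bounded, which is what allows it to be used as a perturbation. The first
derivative vanishes at `0`, so a negative second derivative yields an encoder that beats the trivial
one, which is learnability.

For the Pareto frontier `F`, sharing an encoder with the trivial one through an erasure flag gives
`t F(r) ≤ F(t r)`. Hence `F(r) / r` is antitone; data processing bounds it by `1`, so its limit at
`0⁺` exists and is its supremum. Learnability at `β` provides a ratio above `1 / β`, and `β` can be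
any number above the infimum. -/

namespace IB

/-! ### Mutual informations of encoders that have a density -/

section Density

variable {X Y Z : Type*} [MeasurableSpace X] [MeasurableSpace Y] [MeasurableSpace Z]

lemma klDiv_withDensity {A : Type*} [MeasurableSpace A] (π : Measure A) [IsFiniteMeasure π]
    {f : A → ℝ≥0∞} (hf : Measurable f) [IsFiniteMeasure (π.withDensity f)] :
    klDiv (π.withDensity f) π = ∫⁻ a, ENNReal.ofReal (klFun (f a).toReal) ∂π := by
  rw [klDiv_eq_lintegral_klFun_of_ac (withDensity_absolutelyContinuous _ _)]
  refine lintegral_congr_ae ?_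
  filter_upwards [Measure.rnDeriv_withDensity π hf] with a ha
  rw [ha]

/-- The conditional law of `X` given `Y`. -/
noncomputable abbrev posteriorKernel [StandardBorelSpace X] [Nonempty X]
    (μ : Measure (X × Y)) [IsFiniteMeasure μ] : Kernel Y X :=
  (μ.map Prod.swap).condKernel

lemma fst_map_swap' (μ : Measure (X × Y)) : (μ.map Prod.swap).fst = μ.snd := by
  rw [Measure.fst, Measure.map_map measurable_fst measurable_swap]; rfl

lemma compProd_posteriorKernel [StandardBorelSpace X] [Nonempty X]
    (μ : Measure (X × Y)) [IsFiniteMeasure μ] :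
    μ.snd ⊗ₘ posteriorKernel μ = μ.map Prod.swap := by
  conv_rhs => rw [← (μ.map Prod.swap).disintegrate (μ.map Prod.swap).condKernel]
  rw [fst_map_swap']

lemma lintegral_posteriorKernel [StandardBorelSpace X] [Nonempty X]
    (μ : Measure (X × Y)) [IsFiniteMeasure μ] {k : X × Y → ℝ≥0∞} (hk : Measurable k) :
    ∫⁻ y, ∫⁻ x, k (x, y) ∂posteriorKernel μ y ∂μ.snd = ∫⁻ w, k w ∂μ := by
  have h := Measure.lintegral_compProd (μ := μ.snd) (κ := posteriorKernel μ)
    (f := fun w => k w.swap) (by fun_prop)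
  rw [compProd_posteriorKernel, lintegral_map (by fun_prop) measurable_swap] at h
  simpa using h.symm

lemma lintegral_posteriorKernel_fst [StandardBorelSpace X] [Nonempty X]
    (μ : Measure (X × Y)) [IsFiniteMeasure μ] {k : X → ℝ≥0∞} (hk : Measurable k) :
    ∫⁻ y, ∫⁻ x, k x ∂posteriorKernel μ y ∂μ.snd = ∫⁻ x, k x ∂μ.fst := by
  rw [lintegral_posteriorKernel μ (k := fun w => k w.1) (by fun_prop), Measure.fst,
    lintegral_map hk measurable_fst]

/-- The two normalisations force the marginals to be `α` and `ν`, so the density is already taken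
relative to the product of the marginals. -/
lemma mutualInfo_withDensity (α : Measure X) [IsFiniteMeasure α] (ν : Measure Z)
    [IsFiniteMeasure ν] {f : X → Z → ℝ≥0∞} (hf : Measurable (Function.uncurry f))
    (h₁ : ∀ᵐ x ∂α, ∫⁻ z, f x z ∂ν = 1) (h₂ : ∀ᵐ z ∂ν, ∫⁻ x, f x z ∂α = 1) :
    mutualInfo ((α.prod ν).withDensity (fun w => f w.1 w.2)) =
      ∫⁻ w, ENNReal.ofReal (klFun (f w.1 w.2).toReal) ∂(α.prod ν) := by
  have hf' : Measurable (fun w : X × Z => f w.1 w.2) := hf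
  have e₁ : ((α.prod ν).withDensity (fun w => f w.1 w.2)).fst = α := by
    refine Measure.ext_of_lintegral _ fun g hg => ?_
    rw [Measure.fst, lintegral_map hg measurable_fst,
      lintegral_withDensity_eq_lintegral_mul _ hf' (by fun_prop),
      lintegral_prod _ (by fun_prop)]
    refine lintegral_congr_ae ?_
    filter_upwards [h₁] with x hx
    simp only [Pi.mul_apply]
    rw [lintegral_mul_const _ (by fun_prop), hx, one_mul]
  have e₂ : ((α.prod ν).withDensity (fun w => f w.1 w.2)).snd = ν := by
    refine Measure.ext_of_lintegral _ fun g hg => ?_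
    rw [Measure.snd, lintegral_map hg measurable_snd,
      lintegral_withDensity_eq_lintegral_mul _ hf' (by fun_prop),
      lintegral_prod_symm' _ (by fun_prop)]
    refine lintegral_congr_ae ?_
    filter_upwards [h₂] with x hx
    simp only [Pi.mul_apply]
    rw [lintegral_mul_const _ (by fun_prop), hx, one_mul]
  have : IsFiniteMeasure ((α.prod ν).withDensity (fun w => f w.1 w.2)) := by
    refine ⟨?_⟩
    have : α Set.univ < ∞ := measure_lt_top _ _
    rwa [← e₁, Measure.fst_univ] at this
  rw [mutualInfo, e₁, e₂, klDiv_withDensity _ hf']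

lemma ae_comp_fst (μ : Measure (X × Y)) {p : X → Prop} (h : ∀ᵐ x ∂μ.fst, p x) :
    ∀ᵐ w ∂μ, p w.1 :=
  ae_of_ae_map measurable_fst.aemeasurable h

variable (μ : Measure (X × Y)) [IsProbabilityMeasure μ] {κ : Kernel X Z}
  {ν : Measure Z} {f : X → Z → ℝ≥0∞}

lemma jointLaw_eq_withDensity [IsMarkovKernel κ] [SFinite ν] (hf : Measurable (Function.uncurry f))
    (hκ : ∀ᵐ x ∂μ.fst, κ x = ν.withDensity (f x)) :
    jointLaw μ κ = (μ.prod ν).withDensity (fun w => f w.1.1 w.2) := by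
  have hf' : Measurable (fun w : (X × Y) × Z => f w.1.1 w.2) :=
    hf.comp (f := fun w : (X × Y) × Z => (w.1.1, w.2)) (by fun_prop)
  refine Measure.ext_of_lintegral _ fun g hg => ?_
  rw [jointLaw, Measure.lintegral_compProd hg,
    lintegral_withDensity_eq_lintegral_mul _ hf' hg, lintegral_prod _ (by fun_prop)]
  refine lintegral_congr_ae ?_
  filter_upwards [ae_comp_fst μ hκ] with w hw
  rw [Kernel.comap_apply, hw,
    lintegral_withDensity_eq_lintegral_mul _ (by fun_prop) (by fun_prop)]
  rfl

lemma map_jointLaw_fst [IsMarkovKernel κ] [SFinite ν] (hf : Measurable (Function.uncurry f))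
    (hκ : ∀ᵐ x ∂μ.fst, κ x = ν.withDensity (f x)) :
    (jointLaw μ κ).map (fun w => (w.1.1, w.2)) =
      (μ.fst.prod ν).withDensity (fun w => f w.1 w.2) := by
  have hf' : Measurable (fun w : (X × Y) × Z => f w.1.1 w.2) :=
    hf.comp (f := fun w : (X × Y) × Z => (w.1.1, w.2)) (by fun_prop)
  have hf'' : Measurable (fun w : X × Z => f w.1 w.2) := hf
  refine Measure.ext_of_lintegral _ fun g hg => ?_
  rw [lintegral_map hg (by fun_prop), jointLaw_eq_withDensity μ hf hκ,
    lintegral_withDensity_eq_lintegral_mul _ hf' (by fun_prop),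
    lintegral_withDensity_eq_lintegral_mul _ hf'' hg,
    lintegral_prod _ (by fun_prop), lintegral_prod _ (by fun_prop), Measure.fst,
    lintegral_map (by fun_prop) measurable_fst]
  rfl

lemma measurable_lintegral_posteriorKernel [StandardBorelSpace X] [Nonempty X]
    (hf : Measurable (Function.uncurry f)) :
    Measurable (Function.uncurry fun (y : Y) (z : Z) => ∫⁻ x, f x z ∂posteriorKernel μ y) := by
  have h := Measurable.lintegral_kernel_prod_right (κ := (posteriorKernel μ).comap
    (Prod.fst : Y × Z → Y) measurable_fst) (f := fun w x => f x w.2)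
    (hf.comp (f := fun w : (Y × Z) × X => (w.2, w.1.2)) (by fun_prop))
  exact h

/-- By the Markov property, conditioning on `y` averages the encoder density over the posterior of
`X`. -/
lemma map_jointLaw_snd [StandardBorelSpace X] [Nonempty X]
    [IsMarkovKernel κ] [SFinite ν] (hf : Measurable (Function.uncurry f))
    (hκ : ∀ᵐ x ∂μ.fst, κ x = ν.withDensity (f x)) :
    (jointLaw μ κ).map (fun w => (w.1.2, w.2)) =
      (μ.snd.prod ν).withDensity (fun w => ∫⁻ x, f x w.2 ∂posteriorKernel μ w.1) := by
  have hf' : Measurable (fun w : (X × Y) × Z => f w.1.1 w.2) :=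
    hf.comp (f := fun w : (X × Y) × Z => (w.1.1, w.2)) (by fun_prop)
  have hf'' : Measurable (fun w : Y × Z => ∫⁻ x, f x w.2 ∂posteriorKernel μ w.1) :=
    measurable_lintegral_posteriorKernel μ hf
  refine Measure.ext_of_lintegral _ fun g hg => ?_
  rw [lintegral_map hg (by fun_prop), jointLaw_eq_withDensity μ hf hκ,
    lintegral_withDensity_eq_lintegral_mul _ hf' (by fun_prop),
    lintegral_withDensity_eq_lintegral_mul _ hf'' hg,
    lintegral_prod_symm' _ (by fun_prop), lintegral_prod_symm' _ (by fun_prop)]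
  refine lintegral_congr fun z => ?_
  have hz : Measurable fun w : X × Y => f w.1 z * g (w.2, z) :=
    (hf.comp (f := fun w : X × Y => (w.1, z)) (by fun_prop)).mul (by fun_prop)
  have := lintegral_posteriorKernel μ hz
  simp only [Pi.mul_apply]
  rw [← this]
  refine lintegral_congr fun y => ?_
  have hxz : Measurable fun x => f x z := hf.comp (f := fun x : X => (x, z)) (by fun_prop)
  change ∫⁻ x, f x z * g (y, z) ∂posteriorKernel μ y = _
  exact lintegral_mul_const _ hxz

lemma infoXZ_eq_lintegral [IsMarkovKernel κ] [IsProbabilityMeasure ν]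
    (hf : Measurable (Function.uncurry f)) (hκ : ∀ᵐ x ∂μ.fst, κ x = ν.withDensity (f x))
    (h₂ : ∀ᵐ z ∂ν, ∫⁻ x, f x z ∂μ.fst = 1) :
    infoXZ μ κ = ∫⁻ w, ENNReal.ofReal (klFun (f w.1 w.2).toReal) ∂(μ.fst.prod ν) := by
  rw [infoXZ, map_jointLaw_fst μ hf hκ, mutualInfo_withDensity _ _ hf ?_ h₂]
  filter_upwards [hκ] with x hx
  rw [← setLIntegral_univ, ← withDensity_apply _ .univ, ← hx, measure_univ]

lemma infoYZ_eq_lintegral [StandardBorelSpace X] [Nonempty X]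
    [IsMarkovKernel κ] [IsProbabilityMeasure ν]
    (hf : Measurable (Function.uncurry f)) (hκ : ∀ᵐ x ∂μ.fst, κ x = ν.withDensity (f x))
    (h₂ : ∀ᵐ z ∂ν, ∫⁻ x, f x z ∂μ.fst = 1) :
    infoYZ μ κ = ∫⁻ w, ENNReal.ofReal
      (klFun (∫⁻ x, f x w.2 ∂posteriorKernel μ w.1).toReal) ∂(μ.snd.prod ν) := by
  rw [infoYZ, map_jointLaw_snd μ hf hκ, mutualInfo_withDensity _ _ (f := fun y z =>
    ∫⁻ x, f x z ∂posteriorKernel μ y) (measurable_lintegral_posteriorKernel μ hf)]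
  · have hx : ∀ᵐ x ∂μ.fst, ∫⁻ z, f x z ∂ν = 1 := by
      filter_upwards [hκ] with x hx
      rw [← setLIntegral_univ, ← withDensity_apply _ .univ, ← hx, measure_univ]
    have hxy : ∀ᵐ y ∂μ.snd, ∀ᵐ x ∂posteriorKernel μ y, ∫⁻ z, f x z ∂ν = 1 := by
      refine Measure.ae_ae_of_ae_compProd (p := fun w : Y × X => ∫⁻ z, f w.2 z ∂ν = 1) ?_
      rw [compProd_posteriorKernel]
      refine (ae_map_iff (by fun_prop) ?_).2 (ae_comp_fst μ hx)
      exact measurableSet_eq_fun ((Measurable.lintegral_prod_right' hf).comp measurable_snd)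
        measurable_const
    filter_upwards [hxy] with y hy
    rw [lintegral_lintegral_swap]
    · rw [lintegral_congr_ae hy]; simp
    · exact (hf.comp (f := fun w : Z × X => (w.2, w.1)) (by fun_prop)).aemeasurable
  · filter_upwards [h₂] with z hz
    rw [lintegral_posteriorKernel_fst μ (k := fun x => f x z)
      (hf.comp (f := fun x : X => (x, z)) (by fun_prop)), hz]

end Density


/-! ### Existence of densities, data processing, trivial encoders -/

section DataProcessing

variable {X Y Z : Type*} [MeasurableSpace X] [MeasurableSpace Y] [MeasurableSpace Z]

lemma isMarkovKernel_const_withDensity {ν : Measure Z} [SFinite ν] {f : X → Z → ℝ≥0∞}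
    (hf : Measurable (Function.uncurry f)) (h : ∀ x, ∫⁻ z, f x z ∂ν = 1) :
    IsMarkovKernel ((Kernel.const X ν).withDensity f) := by
  refine ⟨fun x => ⟨?_⟩⟩
  rw [Kernel.withDensity_apply _ hf, withDensity_apply _ .univ, setLIntegral_univ,
    Kernel.const_apply, h]

lemma ae_eq_one_of_withDensity_eq_self {α : Measure X} [SigmaFinite α] {g : X → ℝ≥0∞}
    (hg : Measurable g) (h : α.withDensity g = α) : ∀ᵐ x ∂α, g x = 1 := by
  have h' : α.withDensity g = α.withDensity 1 := by rw [h, withDensity_one]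
  exact (withDensity_eq_iff_of_sigmaFinite hg.aemeasurable measurable_one.aemeasurable).1 h'

lemma snd_map_jointLaw_fst (μ : Measure (X × Y)) (κ : Kernel X Z) :
    ((jointLaw μ κ).map (fun w => (w.1.1, w.2))).snd = (jointLaw μ κ).snd := by
  rw [Measure.snd, Measure.snd, Measure.map_map (by fun_prop) (by fun_prop)]
  rfl

lemma snd_map_jointLaw_snd (μ : Measure (X × Y)) (κ : Kernel X Z) :
    ((jointLaw μ κ).map (fun w => (w.1.2, w.2))).snd = (jointLaw μ κ).snd := by
  rw [Measure.snd, Measure.snd, Measure.map_map (by fun_prop) (by fun_prop)]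
  rfl

variable (μ : Measure (X × Y)) [IsProbabilityMeasure μ] (κ : Kernel X Z) [IsMarkovKernel κ]

lemma isProbabilityMeasure_jointLaw : IsProbabilityMeasure (jointLaw μ κ) := by
  unfold jointLaw; infer_instance

lemma fst_jointLaw : (jointLaw μ κ).fst = μ := by
  unfold jointLaw; exact Measure.fst_compProd _ _

lemma fst_map_jointLaw_fst : ((jointLaw μ κ).map (fun w => (w.1.1, w.2))).fst = μ.fst := by
  conv_rhs => rw [← fst_jointLaw μ κ]
  rw [Measure.fst, Measure.fst, Measure.fst, Measure.map_map (by fun_prop) (by fun_prop),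
    Measure.map_map (by fun_prop) (by fun_prop)]
  rfl

lemma fst_map_jointLaw_snd : ((jointLaw μ κ).map (fun w => (w.1.2, w.2))).fst = μ.snd := by
  conv_rhs => rw [← fst_jointLaw μ κ]
  rw [Measure.fst, Measure.fst, Measure.snd, Measure.map_map (by fun_prop) (by fun_prop),
    Measure.map_map (by fun_prop) (by fun_prop)]
  rfl

lemma map_jointLaw_fst_eq_compProd :
    (jointLaw μ κ).map (fun w => (w.1.1, w.2)) = μ.fst ⊗ₘ κ := by
  refine Measure.ext_of_lintegral _ fun g hg => ?_
  rw [lintegral_map hg (by fun_prop), jointLaw, Measure.lintegral_compProd (by fun_prop),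
    Measure.lintegral_compProd hg, Measure.fst,
    lintegral_map (hg.lintegral_kernel_prod_right') measurable_fst]
  rfl

/-- An encoder with finite `I(X;Z)` has conditional densities relative to the law of `Z`. -/
lemma exists_density_of_infoXZ_ne_top [StandardBorelSpace Z] (h : infoXZ μ κ ≠ ∞) :
    ∃ f : X → Z → ℝ≥0∞, Measurable (Function.uncurry f) ∧
      (∀ x, ∫⁻ z, f x z ∂(jointLaw μ κ).snd = 1) ∧
      (∀ᵐ x ∂μ.fst, κ x = (jointLaw μ κ).snd.withDensity (f x)) ∧
      (∀ᵐ z ∂(jointLaw μ κ).snd, ∫⁻ x, f x z ∂μ.fst = 1) := by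
  have := isProbabilityMeasure_jointLaw μ κ
  set ν := (jointLaw μ κ).snd with hν
  set ρ := (jointLaw μ κ).map (fun w => (w.1.1, w.2)) with hρ
  have hρ1 : ρ.fst = μ.fst := fst_map_jointLaw_fst μ κ
  have hρ2 : ρ.snd = ν := snd_map_jointLaw_fst μ κ
  have : IsProbabilityMeasure ρ := Measure.isProbabilityMeasure_map (by fun_prop)
  have hac : ρ ≪ μ.fst.prod ν := by
    rw [infoXZ, mutualInfo, klDiv_ne_top_iff, ← hρ, hρ1, hρ2] at h
    exact h.1
  let f₁ : X → Z → ℝ≥0∞ := fun x z => ((ρ.rnDeriv (μ.fst.prod ν) (x, z)).toNNReal : ℝ≥0∞)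
  have hf₁ : Measurable (Function.uncurry f₁) :=
    (Measure.measurable_rnDeriv _ _).ennreal_toNNReal.coe_nnreal_ennreal
  have hf₁' : Measurable fun w : X × Z => f₁ w.1 w.2 := hf₁
  have hρf₁ : ρ = (μ.fst.prod ν).withDensity (fun w => f₁ w.1 w.2) := by
    conv_lhs => rw [← Measure.withDensity_rnDeriv_eq _ _ hac]
    refine withDensity_congr_ae ?_
    filter_upwards [Measure.rnDeriv_lt_top ρ (μ.fst.prod ν)] with w hw
    exact (ENNReal.coe_toNNReal hw.ne).symm
  have h1 : ∀ᵐ x ∂μ.fst, ∫⁻ z, f₁ x z ∂ν = 1 := by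
    refine ae_eq_one_of_withDensity_eq_self hf₁.lintegral_prod_right' ?_
    refine Measure.ext_of_lintegral _ fun g hg => ?_
    conv_rhs => rw [← hρ1, Measure.fst, lintegral_map hg measurable_fst, hρf₁,
      lintegral_withDensity_eq_lintegral_mul _ hf₁' (by fun_prop),
      lintegral_prod _ (by fun_prop)]
    have hm : Measurable fun x => ∫⁻ z, f₁ x z ∂ν := hf₁.lintegral_prod_right'
    rw [lintegral_withDensity_eq_lintegral_mul _ hm hg]
    refine lintegral_congr fun x => ?_
    have hx : Measurable (f₁ x) := hf₁.comp (f := fun z : Z => (x, z)) (by fun_prop)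
    exact (lintegral_mul_const _ hx).symm
  have h2 : ∀ᵐ z ∂ν, ∫⁻ x, f₁ x z ∂μ.fst = 1 := by
    refine ae_eq_one_of_withDensity_eq_self hf₁.lintegral_prod_left' ?_
    refine Measure.ext_of_lintegral _ fun g hg => ?_
    conv_rhs => rw [← hρ2, Measure.snd, lintegral_map hg measurable_snd, hρf₁,
      lintegral_withDensity_eq_lintegral_mul _ hf₁' (by fun_prop),
      lintegral_prod_symm' _ (by fun_prop)]
    have hm : Measurable fun z => ∫⁻ x, f₁ x z ∂μ.fst := hf₁.lintegral_prod_left'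
    rw [lintegral_withDensity_eq_lintegral_mul _ hm hg]
    refine lintegral_congr fun z => ?_
    have hz : Measurable (fun x => f₁ x z) := hf₁.comp (f := fun x : X => (x, z)) (by fun_prop)
    exact (lintegral_mul_const _ hz).symm
  classical
  -- Resetting the density to `1` on the null set of `x` where it is not normalised makes it a
  -- Markov kernel at every `x`.
  let f : X → Z → ℝ≥0∞ := fun x z => if ∫⁻ z, f₁ x z ∂ν = 1 then f₁ x z else 1
  have hf : Measurable (Function.uncurry f) := by
    refine Measurable.ite ?_ hf₁ measurable_const
    exact measurableSet_eq_fun (hf₁.lintegral_prod_right'.comp measurable_fst) measurable_const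
  have hff : ∀ᵐ x ∂μ.fst, f x = f₁ x := by
    filter_upwards [h1] with x hx
    simp [f, hx]
  have hf1 : ∀ x, ∫⁻ z, f x z ∂ν = 1 := by
    intro x
    by_cases hx : ∫⁻ z, f₁ x z ∂ν = 1
    · simp only [f, if_pos hx]; exact hx
    · simp only [f, if_neg hx]; simp
  refine ⟨f, hf, hf1, ?_, ?_⟩
  · have hM := isMarkovKernel_const_withDensity hf hf1
    have hae : κ =ᵐ[μ.fst] (Kernel.const X ν).withDensity f := by
      -- Both kernels disintegrate the law of `(X, Z)`, and disintegrations are a.e. unique.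
      refine Kernel.ae_eq_of_compProd_eq ?_
      rw [Measure.compProd_withDensity hf, Measure.compProd_const,
        ← map_jointLaw_fst_eq_compProd, ← hρ, hρf₁]
      refine withDensity_congr_ae ?_
      have : ∀ᵐ w ∂(μ.fst.prod ν), f w.1 = f₁ w.1 := Measure.quasiMeasurePreserving_fst.ae hff
      filter_upwards [this] with w hw
      rw [hw]
    filter_upwards [hae] with x hx
    rw [hx, Kernel.withDensity_apply _ hf, Kernel.const_apply]
  · filter_upwards [h2] with z hz
    rw [← hz]
    refine lintegral_congr_ae ?_
    filter_upwards [hff] with x hx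
    rw [hx]

/-- The data processing inequality for the Markov chain `Z ← X ↔ Y`. -/
lemma infoYZ_le_infoXZ [StandardBorelSpace Z] : infoYZ μ κ ≤ infoXZ μ κ := by
  by_cases h : infoXZ μ κ = ∞
  · simp [h]
  have := isProbabilityMeasure_jointLaw μ κ
  obtain ⟨f, hf, -, hκ, h2⟩ := exists_density_of_infoXZ_ne_top μ κ h
  rw [infoXZ_eq_lintegral μ hf hκ h2, infoYZ, mutualInfo, fst_map_jointLaw_snd,
    snd_map_jointLaw_snd]
  set ν := (jointLaw μ κ).snd
  -- The law of `((X, Y), Z)` has density `f x z` relative to `μ × ν`. Projecting to `(Y, Z)` can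
  -- only decrease the divergence, and before projection it equals `I(X;Z)` because the density does
  -- not depend on `y`.
  have e : μ.snd.prod ν = (μ.prod ν).map (fun w => (w.1.2, w.2)) := by
    have := Measure.map_prod_map μ ν (f := Prod.snd) (g := id) measurable_snd measurable_id
    rw [Measure.map_id] at this
    exact this
  rw [e]
  refine (klDiv_map_le _ _ (by fun_prop)).trans ?_
  have hf' : Measurable (fun w : (X × Y) × Z => f w.1.1 w.2) :=
    hf.comp (f := fun w : (X × Y) × Z => (w.1.1, w.2)) (by fun_prop)
  have hf'' : Measurable (fun w : X × Z => f w.1 w.2) := hf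
  have hj := jointLaw_eq_withDensity μ hf hκ
  have : IsFiniteMeasure ((μ.prod ν).withDensity fun w => f w.1.1 w.2) := by
    rw [← hj]; infer_instance
  rw [hj, klDiv_withDensity _ hf', lintegral_prod _ (by fun_prop), lintegral_prod _ (by fun_prop),
    Measure.fst, lintegral_map (by fun_prop) measurable_fst]

lemma infoXZ_const (ν : Measure Z) [IsProbabilityMeasure ν] :
    infoXZ μ (Kernel.const X ν) = 0 := by
  rw [infoXZ, mutualInfo, fst_map_jointLaw_fst, snd_map_jointLaw_fst, jointLaw]
  have : (Kernel.const X ν).comap (Prod.fst : X × Y → X) measurable_fst = Kernel.const _ ν := rfl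
  rw [this, Measure.compProd_const, Measure.snd_prod]
  have e : (μ.prod ν).map (fun w => (w.1.1, w.2)) = μ.fst.prod ν := by
    have := Measure.map_prod_map μ ν (f := Prod.fst) (g := id) measurable_fst measurable_id
    rw [Measure.map_id] at this
    exact this.symm
  rw [e, klDiv_self]

lemma infoYZ_const (ν : Measure Z) [IsProbabilityMeasure ν] :
    infoYZ μ (Kernel.const X ν) = 0 := by
  rw [infoYZ, mutualInfo, fst_map_jointLaw_snd, snd_map_jointLaw_snd, jointLaw]
  have : (Kernel.const X ν).comap (Prod.fst : X × Y → X) measurable_fst = Kernel.const _ ν := rfl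
  rw [this, Measure.compProd_const, Measure.snd_prod]
  have e : (μ.prod ν).map (fun w => (w.1.2, w.2)) = μ.snd.prod ν := by
    have := Measure.map_prod_map μ ν (f := Prod.snd) (g := id) measurable_snd measurable_id
    rw [Measure.map_id] at this
    exact this.symm
  rw [e, klDiv_self]

end DataProcessing


/-! ### The Pareto frontier and its slope at the origin -/

section Pareto

variable {X Y Z : Type*} [MeasurableSpace X] [MeasurableSpace Y] [MeasurableSpace Z]

/-- The law of an erasure flag: `true` has probability `t`. -/
noncomputable def erasureLaw (t : ℝ≥0∞) : Measure Bool :=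
  t • Measure.dirac true + (1 - t) • Measure.dirac false

lemma lintegral_erasureLaw (t : ℝ≥0∞) (k : Bool → ℝ≥0∞) :
    ∫⁻ b, k b ∂erasureLaw t = t * k true + (1 - t) * k false := by
  rw [erasureLaw, lintegral_add_measure, lintegral_smul_measure, lintegral_smul_measure,
    lintegral_dirac, lintegral_dirac]
  rfl

lemma isProbabilityMeasure_erasureLaw {t : ℝ≥0∞} (ht : t ≤ 1) :
    IsProbabilityMeasure (erasureLaw t) := by
  refine ⟨?_⟩
  rw [← lintegral_one, lintegral_erasureLaw]
  simp [add_tsub_cancel_of_le ht]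

lemma measurable_erasure {A : Type*} [MeasurableSpace A] {k : A → Z → ℝ≥0∞}
    (hk : Measurable (Function.uncurry k)) (c : ℝ≥0∞) :
    Measurable (Function.uncurry fun (a : A) (w : Z × Bool) => if w.2 then k a w.1 else c) := by
  refine Measurable.ite (p := fun w : A × (Z × Bool) => w.2.2 = true) ?_ ?_ measurable_const
  · exact (measurable_snd.comp measurable_snd) (measurableSet_singleton true)
  · exact hk.comp (f := fun w : A × (Z × Bool) => (w.1, w.2.1)) (by fun_prop)

/-- An erased symbol has density `1`, where `klFun` vanishes, so only the flag `true` contributes to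
an information. -/
lemma lintegral_prod_erasureLaw {t : ℝ≥0∞} (ht : t ≤ 1) (α : Measure X)
    [SFinite α] (ν : Measure Z) [SFinite ν] {k : X → Z → ℝ≥0∞}
    (hk : Measurable (Function.uncurry k)) :
    ∫⁻ w, (if w.2.2 then k w.1 w.2.1 else 0) ∂(α.prod (ν.prod (erasureLaw t))) =
      t * ∫⁻ w, k w.1 w.2 ∂(α.prod ν) := by
  have := isProbabilityMeasure_erasureLaw ht
  have hm : Measurable fun w : X × (Z × Bool) => if w.2.2 then k w.1 w.2.1 else 0 :=
    measurable_erasure hk 0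
  have hk' : Measurable fun w : X × Z => k w.1 w.2 := hk
  rw [lintegral_prod _ hm.aemeasurable, lintegral_prod _ hk'.aemeasurable,
    ← lintegral_const_mul _ hk'.lintegral_prod_right']
  refine lintegral_congr fun x => ?_
  have hm' : Measurable fun w : Z × Bool => if w.2 then k x w.1 else 0 :=
    hm.comp (f := fun w : Z × Bool => (x, w)) (by fun_prop)
  have hkx : Measurable fun z => k x z := hk.comp (f := fun z : Z => (x, z)) (by fun_prop)
  change ∫⁻ w : Z × Bool, (if w.2 then k x w.1 else 0) ∂_ = t * ∫⁻ z, k x z ∂ν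
  rw [lintegral_prod _ hm'.aemeasurable, ← lintegral_const_mul _ hkx]
  refine lintegral_congr fun z => ?_
  rw [lintegral_erasureLaw]
  simp

lemma paretoFrontier_nonneg (μ : Measure (X × Y)) (r : ℝ) : 0 ≤ paretoFrontier μ r := by
  refine Real.sSup_nonneg ?_
  rintro _ ⟨Z, _, _, κ, _, -, rfl⟩
  exact ENNReal.toReal_nonneg

variable (μ : Measure (X × Y)) [IsProbabilityMeasure μ]

/-- Data processing bounds the set defining the frontier, so its `sSup` is a genuine supremum. -/
lemma le_of_mem_paretoSet {r t : ℝ} (hr : 0 ≤ r)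
    (h : ∃ (Z : Type) (_ : MeasurableSpace Z) (_ : StandardBorelSpace Z) (κ : Kernel X Z),
      IsMarkovKernel κ ∧ infoXZ μ κ ≤ ENNReal.ofReal r ∧ t = (infoYZ μ κ).toReal) : t ≤ r := by
  obtain ⟨Z, _, _, κ, _, hκ, rfl⟩ := h
  exact ENNReal.toReal_le_of_le_ofReal hr ((infoYZ_le_infoXZ μ κ).trans hκ)

lemma paretoFrontier_le {r : ℝ} (hr : 0 ≤ r) : paretoFrontier μ r ≤ r :=
  Real.sSup_le (fun _ h => le_of_mem_paretoSet μ hr h) hr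

lemma le_paretoFrontier {r : ℝ} (hr : 0 ≤ r) {Z : Type} [MeasurableSpace Z] [StandardBorelSpace Z]
    (κ : Kernel X Z) [IsMarkovKernel κ] (h : infoXZ μ κ ≤ ENNReal.ofReal r) :
    (infoYZ μ κ).toReal ≤ paretoFrontier μ r :=
  le_csSup ⟨r, fun _ h => le_of_mem_paretoSet μ hr h⟩ ⟨Z, _, ‹_›, κ, ‹_›, h, rfl⟩

/-- Trivial encoders have objective `0`, so learnability means `I(X;Z) < β I(Y;Z)` for some encoder;
this encoder competes in the frontier at `r = I(X;Z)`, positive by data processing. -/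
lemma lt_slope_of_isLearnable [Nonempty X] {s : ℝ}
    (hs : ∀ r, 0 < r → paretoFrontier μ r / r ≤ s) {β : ℝ}
    (hβ : 0 < β) (h : IsLearnable μ β) : β⁻¹ < s := by
  obtain ⟨Z, _, _, κ, hM, hfin, hobj⟩ := h
  have hne : Nonempty Z := by
    obtain ⟨x⟩ := ‹Nonempty X›
    exact (κ x).nonempty_of_neZero
  have hobj := hobj (Measure.dirac hne.some) inferInstance
  rw [objective, objective, infoXZ_const, infoYZ_const] at hobj
  simp only [ENNReal.toReal_zero, mul_zero, sub_zero] at hobj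
  set a := (infoXZ μ κ).toReal with ha
  set b := (infoYZ μ κ).toReal
  have hba : b ≤ a := ENNReal.toReal_mono hfin (infoYZ_le_infoXZ μ κ)
  have ha0 : 0 ≤ a := ENNReal.toReal_nonneg
  have hb0 : 0 < b := by
    by_contra hb
    nlinarith
  have hapos : 0 < a := hb0.trans_le hba
  have h1 := le_paretoFrontier μ hapos.le κ (by rw [ha, ENNReal.ofReal_toReal hfin])
  refine lt_of_lt_of_le ?_ (hs a hapos)
  rw [inv_lt_iff_one_lt_mul₀ hβ, div_mul_eq_mul_div, lt_div_iff₀ hapos]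
  nlinarith

variable [StandardBorelSpace X] [Nonempty X]

/-- Transmitting `Z` with probability `t`, and an independent copy of it otherwise, together with
the flag, multiplies both informations by `t`. -/
lemma exists_encoder_scaling_info [StandardBorelSpace Z] (κ : Kernel X Z) [IsMarkovKernel κ]
    (h : infoXZ μ κ ≠ ∞) {t : ℝ≥0∞} (ht : t ≤ 1) :
    ∃ κ' : Kernel X (Z × Bool), IsMarkovKernel κ' ∧ infoXZ μ κ' = t * infoXZ μ κ ∧
      infoYZ μ κ' = t * infoYZ μ κ := by
  have := isProbabilityMeasure_jointLaw μ κ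
  have := isProbabilityMeasure_erasureLaw ht
  obtain ⟨f, hf, hf1, hκ, h2⟩ := exists_density_of_infoXZ_ne_top μ κ h
  set ν := (jointLaw μ κ).snd
  -- Density relative to `ν × erasureLaw t`: the value `1` on the flag `false` means that `Z` is
  -- then drawn from `ν`, independently of `x`.
  let f' : X → Z × Bool → ℝ≥0∞ := fun x w => if w.2 then f x w.1 else 1
  have hf' : Measurable (Function.uncurry f') := measurable_erasure hf 1
  have hf1' : ∀ x, ∫⁻ w, f' x w ∂(ν.prod (erasureLaw t)) = 1 := by
    intro x
    have hx : Measurable (f' x) := hf'.comp (f := fun w : Z × Bool => (x, w)) (by fun_prop)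
    have hx' : Measurable (f x) := hf.comp (f := fun z : Z => (x, z)) (by fun_prop)
    rw [lintegral_prod _ hx.aemeasurable]
    simp only [f', lintegral_erasureLaw, if_true, Bool.false_eq_true, if_false, mul_one]
    rw [lintegral_add_right _ measurable_const, lintegral_const_mul _ hx', hf1]
    simp [add_tsub_cancel_of_le ht]
  have hM := isMarkovKernel_const_withDensity hf' hf1'
  have hκ' : ∀ᵐ x ∂μ.fst, ((Kernel.const X (ν.prod (erasureLaw t))).withDensity f') x =
      (ν.prod (erasureLaw t)).withDensity (f' x) := by
    refine ae_of_all _ fun x => ?_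
    rw [Kernel.withDensity_apply _ hf', Kernel.const_apply]
  have h2' : ∀ᵐ w ∂(ν.prod (erasureLaw t)), ∫⁻ x, f' x w ∂μ.fst = 1 := by
    have : ∀ᵐ w ∂(ν.prod (erasureLaw t)), ∫⁻ x, f x w.1 ∂μ.fst = 1 :=
      Measure.quasiMeasurePreserving_fst.ae h2
    filter_upwards [this] with w hw
    by_cases hb : w.2 = true
    · simp only [f', hb, if_true]; exact hw
    · simp [f', hb]
  refine ⟨_, hM, ?_, ?_⟩
  · rw [infoXZ_eq_lintegral μ hf' hκ' h2', infoXZ_eq_lintegral μ hf hκ h2,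
      ← lintegral_prod_erasureLaw ht (k := fun x z => ENNReal.ofReal (klFun (f x z).toReal))
        _ _ (by exact (measurable_klFun.comp hf.ennreal_toReal).ennreal_ofReal)]
    refine lintegral_congr fun w => ?_
    by_cases hb : w.2.2 = true
    · simp [f', hb]
    · simp [f', hb, klFun_one]
  · have hfY := measurable_lintegral_posteriorKernel μ hf
    rw [infoYZ_eq_lintegral μ hf' hκ' h2', infoYZ_eq_lintegral μ hf hκ h2,
      ← lintegral_prod_erasureLaw ht (k := fun y z => ENNReal.ofReal
        (klFun (∫⁻ x, f x z ∂posteriorKernel μ y).toReal))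
        _ _ (by exact (measurable_klFun.comp hfY.ennreal_toReal).ennreal_ofReal)]
    refine lintegral_congr fun w => ?_
    by_cases hb : w.2.2 = true
    · simp [f', hb]
    · simp [f', hb, klFun_one]

/-- The erasure construction turns each competitor at `r` into one at `t * r` with `t` times the
information. This part of concavity suffices for a slope at the origin. -/
lemma mul_paretoFrontier_le {t r : ℝ} (ht : 0 ≤ t) (ht1 : t ≤ 1) (hr : 0 ≤ r) :
    t * paretoFrontier μ r ≤ paretoFrontier μ (t * r) := by
  rcases ht.eq_or_lt with rfl | ht0
  · simpa using paretoFrontier_nonneg μ 0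
  rw [mul_comm, ← le_div_iff₀ ht0]
  refine Real.sSup_le ?_ (div_nonneg (paretoFrontier_nonneg μ _) ht)
  rintro _ ⟨Z, _, _, κ, _, hκ, rfl⟩
  rw [le_div_iff₀ ht0]
  have h1 : ENNReal.ofReal t ≤ 1 := ENNReal.ofReal_le_one.2 ht1
  obtain ⟨κ', hM, hX, hY⟩ := exists_encoder_scaling_info μ κ
    (ne_top_of_le_ne_top ENNReal.ofReal_ne_top hκ) h1
  have := le_paretoFrontier μ (mul_nonneg ht hr) κ' (by
    rw [hX, ENNReal.ofReal_mul ht]; gcongr)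
  rw [hY, ENNReal.toReal_mul, ENNReal.toReal_ofReal ht] at this
  linarith

/-- The Pareto frontier has a right derivative at the origin, which dominates all the ratios
`I(Y;Z) / I(X;Z)`. -/
lemma exists_hasDerivWithinAt_paretoFrontier :
    ∃ s : ℝ, HasDerivWithinAt (paretoFrontier μ) s (Set.Ici 0) 0 ∧
      ∀ r, 0 < r → paretoFrontier μ r / r ≤ s := by
  have h0 : paretoFrontier μ 0 = 0 :=
    le_antisymm (paretoFrontier_le μ le_rfl) (paretoFrontier_nonneg μ 0)
  have hanti : AntitoneOn (fun r => paretoFrontier μ r / r) (Set.Ioi 0) := by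
    intro a ha b hb hab
    have ha' : 0 < a := ha
    have hb' : 0 < b := hb
    have := mul_paretoFrontier_le μ (t := a / b) (r := b) (by positivity)
      ((div_le_one hb').2 hab) hb'.le
    rw [div_mul_cancel₀ _ hb'.ne'] at this
    change paretoFrontier μ b / b ≤ paretoFrontier μ a / a
    rw [le_div_iff₀ ha']
    calc _ = a / b * paretoFrontier μ b := by ring
      _ ≤ _ := this
  have hbdd : BddAbove ((fun r => paretoFrontier μ r / r) '' Set.Ioi 0) := by
    refine ⟨1, ?_⟩
    rintro _ ⟨r, hr, rfl⟩
    exact (div_le_one (Set.mem_Ioi.1 hr)).2 (paretoFrontier_le μ (le_of_lt hr))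
  refine ⟨_, ?_, fun r hr => le_csSup hbdd ⟨r, hr, rfl⟩⟩
  rw [hasDerivWithinAt_iff_tendsto_slope, Set.Ici_sdiff_left]
  refine (hanti.tendsto_nhdsGT hbdd).congr fun r => ?_
  rw [slope_def_field, h0, sub_zero, sub_zero]

end Pareto


/-! ### Differentiating integrals of `klFun (1 + ε g)` twice -/

section Expansion

variable {A Z : Type*} [MeasurableSpace A] [MeasurableSpace Z]

/-- The radius `(2 * M)⁻¹` keeps `1 + ε g` in `[1/2, 3/2]`, where `klFun`, its derivative `log` and
the inverse are bounded; these bounds serve as the dominating constants below. -/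
lemma abs_mul_le_half {M ε g : ℝ} (hM : 0 < M) (hε : |ε| < (2 * M)⁻¹) (hg : |g| ≤ M) :
    |ε * g| ≤ 1 / 2 := by
  rw [abs_mul]
  calc |ε| * |g| ≤ (2 * M)⁻¹ * M := mul_le_mul hε.le hg (abs_nonneg _) (by positivity)
    _ = 1 / 2 := by field_simp

lemma abs_log_one_add_le {t : ℝ} (ht : |t| ≤ 1 / 2) : |Real.log (1 + t)| ≤ 1 := by
  obtain ⟨h1, h2⟩ := abs_le.1 ht
  have hpos : 0 < 1 + t := by linarith
  rw [abs_le]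
  constructor
  · refine le_trans ?_ (Real.one_sub_inv_le_log_of_pos hpos)
    have : (1 + t)⁻¹ ≤ 2 := by
      rw [inv_le_comm₀ hpos (by norm_num)]; linarith
    linarith
  · have := Real.log_le_sub_one_of_pos hpos
    linarith

lemma abs_klFun_one_add_le {t : ℝ} (ht : |t| ≤ 1 / 2) : |klFun (1 + t)| ≤ 3 := by
  have hl := abs_log_one_add_le ht
  obtain ⟨h1, h2⟩ := abs_le.1 ht
  have : |(1 + t) * Real.log (1 + t)| ≤ 2 := by
    rw [abs_mul]
    calc |1 + t| * |Real.log (1 + t)| ≤ 2 * 1 := by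
          gcongr
          rw [abs_le]; constructor <;> linarith
      _ = 2 := by norm_num
  obtain ⟨h3, h4⟩ := abs_le.1 this
  rw [klFun_apply, abs_le]
  constructor <;> linarith

lemma integrable_of_abs_le {π : Measure A} [IsFiniteMeasure π] {g : A → ℝ} (hg : Measurable g)
    {M : ℝ} (hM : ∀ a, |g a| ≤ M) : Integrable g π :=
  Integrable.of_bound hg.aestronglyMeasurable M (ae_of_all _ hM)

variable (π : Measure A) [IsFiniteMeasure π] {g : A → ℝ} (hg : Measurable g) {M : ℝ} (hM : 0 < M)
  (hgM : ∀ a, |g a| ≤ M)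

include hg hM hgM

lemma hasDerivAt_integral_klFun {ε : ℝ} (hε : |ε| < (2 * M)⁻¹) :
    HasDerivAt (fun ε => ∫ a, klFun (1 + ε * g a) ∂π) (∫ a, g a * Real.log (1 + ε * g a) ∂π) ε := by
  have hs : Metric.ball (0 : ℝ) (2 * M)⁻¹ ∈ 𝓝 ε :=
    Metric.isOpen_ball.mem_nhds (by simpa using hε)
  refine (hasDerivAt_integral_of_dominated_loc_of_deriv_le (bound := fun _ => M) hs
    (F' := fun ε a => g a * Real.log (1 + ε * g a)) (F := fun ε a => klFun (1 + ε * g a))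
    (Eventually.of_forall fun ε => (by fun_prop : Measurable _).aestronglyMeasurable) ?_
    (by fun_prop : Measurable _).aestronglyMeasurable ?_ (integrable_const _) ?_).2
  · exact integrable_of_abs_le (by fun_prop)
      fun a => abs_klFun_one_add_le (abs_mul_le_half hM hε (hgM a))
  · refine ae_of_all _ fun a x hx => ?_
    have hx' : |x| < (2 * M)⁻¹ := by simpa using hx
    rw [Real.norm_eq_abs, abs_mul]
    calc |g a| * |Real.log (1 + x * g a)| ≤ M * 1 :=
          mul_le_mul (hgM a) (abs_log_one_add_le (abs_mul_le_half hM hx' (hgM a)))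
            (abs_nonneg _) hM.le
      _ = M := mul_one M
  · refine ae_of_all _ fun a x hx => ?_
    have hx' : |x| < (2 * M)⁻¹ := by simpa using hx
    have h := (abs_le.1 (abs_mul_le_half hM hx' (hgM a))).1
    have h1 : HasDerivAt (fun x => 1 + x * g a) (g a) x := by
      simpa using ((hasDerivAt_id x).mul_const (g a)).const_add 1
    have := (hasDerivAt_klFun (x := 1 + x * g a) (by linarith)).comp x h1
    rw [mul_comm] at this
    exact this

lemma hasDerivAt_integral_mul_log :
    HasDerivAt (fun ε => ∫ a, g a * Real.log (1 + ε * g a) ∂π) (∫ a, g a ^ 2 ∂π) 0 := by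
  have hs : Metric.ball (0 : ℝ) (2 * M)⁻¹ ∈ 𝓝 (0 : ℝ) :=
    Metric.ball_mem_nhds _ (by positivity)
  have key := (hasDerivAt_integral_of_dominated_loc_of_deriv_le (μ := π) (x₀ := (0 : ℝ))
    (bound := fun _ => M * (M * 2)) hs
    (F' := fun ε a => g a * (g a / (1 + ε * g a)))
    (F := fun ε a => g a * Real.log (1 + ε * g a))
    (Eventually.of_forall fun ε => (by fun_prop : Measurable _).aestronglyMeasurable) ?_
    (by fun_prop : Measurable _).aestronglyMeasurable ?_ (integrable_const _) ?_).2
  · convert! key using 1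
    refine integral_congr_ae (ae_of_all _ fun a => ?_)
    simp [sq]
  · simp
  · refine ae_of_all _ fun a x hx => ?_
    have hx' : |x| < (2 * M)⁻¹ := by simpa using hx
    have h := (abs_le.1 (abs_mul_le_half hM hx' (hgM a))).1
    have hp : 1 / 2 ≤ 1 + x * g a := by linarith
    rw [Real.norm_eq_abs, abs_mul, abs_div, abs_of_pos (a := 1 + x * g a) (by linarith)]
    have : |g a| / (1 + x * g a) ≤ M * 2 := by
      rw [div_le_iff₀ (by linarith)]
      nlinarith [hgM a]
    exact mul_le_mul (hgM a) this (div_nonneg (abs_nonneg _) (by linarith)) hM.le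
  · refine ae_of_all _ fun a x hx => ?_
    have hx' : |x| < (2 * M)⁻¹ := by simpa using hx
    have h := (abs_le.1 (abs_mul_le_half hM hx' (hgM a))).1
    have h1 : HasDerivAt (fun x => 1 + x * g a) (g a) x := by
      simpa using ((hasDerivAt_id x).mul_const (g a)).const_add 1
    exact (h1.log (by linarith)).const_mul (g a)

end Expansion

/-! ### Mutual information of the density `1 + ε G` -/

section MutualInfo

variable {A Z : Type*} [MeasurableSpace A] [MeasurableSpace Z]

/-- Used with `a` the joint density and `b` the density of the perturbed marginal of `Z`: the last
term then averages to zero, which leaves a difference of two `klFun` integrals. -/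
lemma mul_klFun_div {a b : ℝ} (ha : 0 < a) (hb : 0 < b) :
    b * klFun (a / b) = klFun a - klFun b - (a - b) * Real.log b := by
  rw [klFun_apply, klFun_apply, klFun_apply, Real.log_div ha.ne' hb.ne']
  field_simp
  ring

lemma abs_integral_le_of_abs_le {α : Measure A} [IsProbabilityMeasure α] {g : A → ℝ} {M : ℝ}
    (hM : ∀ a, |g a| ≤ M) : |∫ a, g a ∂α| ≤ M := by
  have := norm_integral_le_of_norm_le_const (μ := α) (f := g) (C := M) (ae_of_all _ hM)
  simpa using this

lemma mutualInfo_withDensity_one_add (α : Measure A) [IsProbabilityMeasure α]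
    (ν : Measure Z) [IsProbabilityMeasure ν] {G : A → Z → ℝ} (hG : Measurable (Function.uncurry G))
    {M : ℝ} (hM : 0 < M) (hGM : ∀ a z, |G a z| ≤ M) (h0 : ∀ a, ∫ z, G a z ∂ν = 0)
    {ε : ℝ} (hε : |ε| < (2 * M)⁻¹) :
    mutualInfo ((α.prod ν).withDensity fun w => ENNReal.ofReal (1 + ε * G w.1 w.2)) ≠ ∞ ∧
    (mutualInfo ((α.prod ν).withDensity fun w => ENNReal.ofReal (1 + ε * G w.1 w.2))).toReal =
      (∫ w, klFun (1 + ε * G w.1 w.2) ∂(α.prod ν)) -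
        ∫ z, klFun (1 + ε * ∫ a, G a z ∂α) ∂ν := by
  have hG' : Measurable fun w : A × Z => G w.1 w.2 := hG
  have hGa : ∀ a, Measurable (G a) := fun a => hG.comp (f := fun z : Z => (a, z)) (by fun_prop)
  have hGz : ∀ z, Measurable fun a => G a z :=
    fun z => hG.comp (f := fun a : A => (a, z)) (by fun_prop)
  set m : Z → ℝ := fun z => ∫ a, G a z ∂α with hm
  have hmm : Measurable m :=
    (StronglyMeasurable.integral_prod_left' (μ := α) (f := fun w : A × Z => G w.1 w.2)
      hG'.stronglyMeasurable).measurable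
  have hmM : ∀ z, |m z| ≤ M := fun z => abs_integral_le_of_abs_le fun a => hGM a z
  have hapos : ∀ a z, 0 < 1 + ε * G a z := fun a z => by
    linarith [(abs_le.1 (abs_mul_le_half hM hε (hGM a z))).1]
  have hbpos : ∀ z, 0 < 1 + ε * m z := fun z => by
    linarith [(abs_le.1 (abs_mul_le_half hM hε (hmM z))).1]
  set ν' := ν.withDensity fun z => ENNReal.ofReal (1 + ε * m z) with hν'
  have hfin : IsFiniteMeasure ν' :=
    isFiniteMeasure_withDensity_ofReal
      ((integrable_const 1).add ((integrable_of_abs_le hmm hmM).const_mul ε)).2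
  -- `G` need not be centred in `a`, so the marginal of `Z` moves to `ν'`; dividing by its density
  -- gives the density relative to the product of the true marginals.
  let f : A → Z → ℝ≥0∞ := fun a z => ENNReal.ofReal ((1 + ε * G a z) / (1 + ε * m z))
  have hf : Measurable (Function.uncurry f) := by
    have : Measurable fun w : A × Z =>
      ENNReal.ofReal ((1 + ε * G w.1 w.2) / (1 + ε * m w.2)) := by fun_prop
    exact this
  have hmul : ∀ a z, ENNReal.ofReal (1 + ε * m z) * f a z = ENNReal.ofReal (1 + ε * G a z) := by
    intro a z
    rw [← ENNReal.ofReal_mul (hbpos z).le, mul_div_cancel₀ _ (hbpos z).ne']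
  have hprod : α.prod ν' = (α.prod ν).withDensity fun w => ENNReal.ofReal (1 + ε * m w.2) := by
    rw [hν', prod_withDensity_right (by fun_prop)]
  have hf' : Measurable fun w : A × Z => f w.1 w.2 := hf
  have hlaw : ((α.prod ν).withDensity fun w => ENNReal.ofReal (1 + ε * G w.1 w.2)) =
      (α.prod ν').withDensity fun w => f w.1 w.2 := by
    rw [hprod, ← withDensity_mul _ (by fun_prop) hf']
    congr 1
    ext w
    exact (hmul w.1 w.2).symm
  have h1 : ∀ a, ∫⁻ z, f a z ∂ν' = 1 := by
    intro a
    have hfa : Measurable (f a) := hf.comp (f := fun z : Z => (a, z)) (by fun_prop)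
    rw [hν', lintegral_withDensity_eq_lintegral_mul _ (by fun_prop) hfa]
    have hi : Integrable (fun z => ε * G a z) ν := (integrable_of_abs_le (hGa a) (hGM a)).const_mul ε
    calc _ = ∫⁻ z, ENNReal.ofReal (1 + ε * G a z) ∂ν := lintegral_congr fun z => hmul a z
      _ = ENNReal.ofReal (∫ z, (1 + ε * G a z) ∂ν) :=
        (ofReal_integral_eq_lintegral_ofReal ((integrable_const 1).add hi)
          (ae_of_all _ fun z => (hapos a z).le)).symm
      _ = 1 := by
        rw [integral_add (integrable_const 1) hi, integral_const_mul, h0]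
        simp
  have h2 : ∀ z, ∫⁻ a, f a z ∂α = 1 := by
    intro z
    have hi : Integrable (fun a => ε * G a z) α :=
      (integrable_of_abs_le (hGz z) fun a => hGM a z).const_mul ε
    calc _ = ENNReal.ofReal (∫ a, (1 + ε * G a z) / (1 + ε * m z) ∂α) :=
        (ofReal_integral_eq_lintegral_ofReal (((integrable_const 1).add hi).div_const _)
          (ae_of_all _ fun a => (div_pos (hapos a z) (hbpos z)).le)).symm
      _ = 1 := by
        rw [integral_div, integral_add (integrable_const 1) hi, integral_const_mul]
        simp only [integral_const, probReal_univ, smul_eq_mul, mul_one]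
        rw [div_self (hbpos z).ne', ENNReal.ofReal_one]
  rw [hlaw, mutualInfo_withDensity _ _ hf (ae_of_all _ h1) (ae_of_all _ h2), hprod,
    lintegral_withDensity_eq_lintegral_mul _ (by fun_prop) (by fun_prop)]
  have hpt : ∀ w : A × Z, ((fun w : A × Z => ENNReal.ofReal (1 + ε * m w.2)) *
      fun w : A × Z => ENNReal.ofReal (klFun (f w.1 w.2).toReal)) w =
      ENNReal.ofReal (klFun (1 + ε * G w.1 w.2) - klFun (1 + ε * m w.2) -
        (1 + ε * G w.1 w.2 - (1 + ε * m w.2)) * Real.log (1 + ε * m w.2)) := by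
    intro w
    rw [← mul_klFun_div (hapos _ _) (hbpos _), Pi.mul_apply, ENNReal.ofReal_mul (hbpos _).le,
      ENNReal.toReal_ofReal (div_pos (hapos _ _) (hbpos _)).le]
  have hnonneg : ∀ w : A × Z, 0 ≤ klFun (1 + ε * G w.1 w.2) - klFun (1 + ε * m w.2) -
      (1 + ε * G w.1 w.2 - (1 + ε * m w.2)) * Real.log (1 + ε * m w.2) := by
    intro w
    rw [← mul_klFun_div (hapos _ _) (hbpos _)]
    exact mul_nonneg (hbpos _).le (klFun_nonneg (div_pos (hapos _ _) (hbpos _)).le)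
  have hlogM : ∀ z, |Real.log (1 + ε * m z)| ≤ 1 := fun z =>
    abs_log_one_add_le (abs_mul_le_half hM hε (hmM z))
  have i1 : Integrable (fun w : A × Z => klFun (1 + ε * G w.1 w.2)) (α.prod ν) :=
    integrable_of_abs_le (by fun_prop)
      fun w => abs_klFun_one_add_le (abs_mul_le_half hM hε (hGM w.1 w.2))
  have i2 : Integrable (fun w : A × Z => klFun (1 + ε * m w.2)) (α.prod ν) :=
    integrable_of_abs_le (by fun_prop)
      fun w => abs_klFun_one_add_le (abs_mul_le_half hM hε (hmM w.2))
  have i3 : Integrable (fun w : A × Z => (1 + ε * G w.1 w.2 - (1 + ε * m w.2)) *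
      Real.log (1 + ε * m w.2)) (α.prod ν) := by
    refine integrable_of_abs_le (M := 1) (by fun_prop) fun w => ?_
    rw [abs_mul]
    have h3 := abs_le.1 (abs_mul_le_half hM hε (hGM w.1 w.2))
    have h4 := abs_le.1 (abs_mul_le_half hM hε (hmM w.2))
    have h5 : |1 + ε * G w.1 w.2 - (1 + ε * m w.2)| ≤ 1 := by
      rw [abs_le]; constructor <;> linarith
    calc _ ≤ 1 * 1 := mul_le_mul h5 (hlogM w.2) (abs_nonneg _) zero_le_one
      _ = 1 := one_mul 1
  have e3 : ∫ w, (1 + ε * G w.1 w.2 - (1 + ε * m w.2)) * Real.log (1 + ε * m w.2) ∂(α.prod ν)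
      = 0 := by
    rw [integral_prod_symm _ i3]
    refine integral_eq_zero_of_ae (ae_of_all _ fun z => ?_)
    have hi : Integrable (fun a => ε * G a z) α :=
      (integrable_of_abs_le (hGz z) fun a => hGM a z).const_mul ε
    change ∫ a, (1 + ε * G a z - (1 + ε * m z)) * Real.log (1 + ε * m z) ∂α = 0
    have hi' : Integrable (fun a => 1 + ε * G a z) α := (integrable_const 1).add hi
    rw [integral_mul_const, integral_sub hi' (integrable_const _),
      integral_add (integrable_const 1) hi, integral_const_mul]
    simp [hm]
  have e2 : ∫ w, klFun (1 + ε * m w.2) ∂(α.prod ν) = ∫ z, klFun (1 + ε * m z) ∂ν := by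
    rw [integral_prod_symm _ i2]
    simp
  have i12 : Integrable (fun w : A × Z => klFun (1 + ε * G w.1 w.2) - klFun (1 + ε * m w.2))
    (α.prod ν) := i1.sub i2
  have i123 : Integrable (fun w : A × Z => klFun (1 + ε * G w.1 w.2) - klFun (1 + ε * m w.2) -
    (1 + ε * G w.1 w.2 - (1 + ε * m w.2)) * Real.log (1 + ε * m w.2)) (α.prod ν) := i12.sub i3
  rw [lintegral_congr hpt, ← ofReal_integral_eq_lintegral_ofReal i123 (ae_of_all _ hnonneg)]
  refine ⟨ENNReal.ofReal_ne_top, ?_⟩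
  rw [ENNReal.toReal_ofReal (integral_nonneg hnonneg)]
  rw [integral_sub i12 i3, integral_sub i1 i2, e3, e2, sub_zero]

end MutualInfo


/-! ### Variance inequalities, truncation, and the infimum of `β₀` -/

section BetaProperties

variable {X Y : Type*} [MeasurableSpace X] [MeasurableSpace Y]

lemma betaNum_congr (μ : Measure (X × Y)) {h h' : X → ℝ} (e : h =ᵐ[μ.fst] h') :
    betaNum μ h = betaNum μ h' := by
  have e2 : (fun x => h x ^ 2) =ᵐ[μ.fst] fun x => h' x ^ 2 := e.fun_comp (fun t => t ^ 2)
  rw [betaNum, betaNum, integral_congr_ae e, integral_congr_ae e2]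

/-- Truncation of a real number to `[-n, n]`. -/
noncomputable def clip (n : ℕ) (t : ℝ) : ℝ := max (-n) (min n t)

lemma measurable_clip (n : ℕ) : Measurable (clip n) := by unfold clip; fun_prop

lemma abs_clip_le (n : ℕ) (t : ℝ) : |clip n t| ≤ n := by
  have : (0 : ℝ) ≤ n := n.cast_nonneg
  rw [abs_le]
  exact ⟨le_max_left _ _, max_le (by linarith) (min_le_left _ _)⟩

lemma abs_clip_le_abs (n : ℕ) (t : ℝ) : |clip n t| ≤ |t| := by
  have : (0 : ℝ) ≤ n := n.cast_nonneg
  rw [abs_le]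
  refine ⟨?_, max_le (by linarith [abs_nonneg t]) ((min_le_right _ _).trans (le_abs_self t))⟩
  refine le_trans ?_ (le_max_right _ _)
  exact le_min (by linarith [abs_nonneg t]) (neg_abs_le t)

lemma tendsto_clip (t : ℝ) : Tendsto (fun n => clip n t) atTop (𝓝 t) := by
  obtain ⟨N, hN⟩ := exists_nat_ge |t|
  refine tendsto_const_nhds.congr' ?_
  filter_upwards [eventually_ge_atTop N] with n hn
  have hn' : |t| ≤ n := hN.trans (by exact_mod_cast hn)
  obtain ⟨h1, h2⟩ := abs_le.1 hn'
  rw [clip, min_eq_right h2, max_eq_right h1]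

lemma tendsto_integral_clip {A : Type*} [MeasurableSpace A] {π : Measure A} {g : A → ℝ}
    (hg : Integrable g π) :
    Tendsto (fun n => ∫ a, clip n (g a) ∂π) atTop (𝓝 (∫ a, g a ∂π)) := by
  refine tendsto_integral_of_dominated_convergence (fun a => |g a|)
    (fun n => ((measurable_clip n).comp_aemeasurable hg.1.aemeasurable).aestronglyMeasurable)
    hg.abs (fun n => ae_of_all _ fun a => abs_clip_le_abs n (g a))
    (ae_of_all _ fun a => tendsto_clip (g a))

lemma memLp_clip {A : Type*} [MeasurableSpace A] {π : Measure A} {g : A → ℝ} (hg : MemLp g 2 π)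
    (n : ℕ) : MemLp (fun a => clip n (g a)) 2 π :=
  hg.mono ((measurable_clip n).comp_aemeasurable hg.1.aemeasurable).aestronglyMeasurable
    (ae_of_all _ fun a => abs_clip_le_abs n (g a))

lemma tendsto_betaNum_clip (μ : Measure (X × Y)) [IsProbabilityMeasure μ] {h : X → ℝ}
    (hh : MemLp h 2 μ.fst) :
    Tendsto (fun n => betaNum μ fun x => clip n (h x)) atTop (𝓝 (betaNum μ h)) := by
  refine Tendsto.sub ?_ ((tendsto_integral_clip (hh.integrable one_le_two)).pow 2)
  refine tendsto_integral_of_dominated_convergence (fun x => h x ^ 2)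
    (fun n => (memLp_clip hh n).1.pow 2) hh.integrable_sq
    (fun n => ae_of_all _ fun x => ?_) (ae_of_all _ fun x => (tendsto_clip (h x)).pow 2)
  rw [Real.norm_eq_abs, abs_of_nonneg (sq_nonneg _)]
  exact sq_le_sq.2 (abs_clip_le_abs n (h x))

variable [StandardBorelSpace X] [Nonempty X] (μ : Measure (X × Y)) [IsProbabilityMeasure μ]

lemma map_snd_compProd_posteriorKernel :
    (μ.snd ⊗ₘ posteriorKernel μ).map Prod.snd = μ.fst := by
  rw [compProd_posteriorKernel, Measure.map_map measurable_snd measurable_swap]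
  rfl

lemma ae_ae_posteriorKernel {p : X → Prop} (h : ∀ᵐ x ∂μ.fst, p x) :
    ∀ᵐ y ∂μ.snd, ∀ᵐ x ∂posteriorKernel μ y, p x := by
  rw [← map_snd_compProd_posteriorKernel μ] at h
  exact Measure.ae_ae_of_ae_compProd (ae_of_ae_map measurable_snd.aemeasurable h)

variable {h : X → ℝ}

lemma integrable_comp_snd_compProd (hi : Integrable h μ.fst) :
    Integrable (fun w : Y × X => h w.2) (μ.snd ⊗ₘ posteriorKernel μ) := by
  rw [← map_snd_compProd_posteriorKernel μ] at hi
  exact hi.comp_measurable measurable_snd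

lemma ae_integrable_posteriorKernel (hi : Integrable h μ.fst) :
    ∀ᵐ y ∂μ.snd, Integrable h (posteriorKernel μ y) := by
  have := integrable_comp_snd_compProd μ hi
  exact ((Measure.integrable_compProd_iff this.1).1 this).1

lemma integrable_integral_posteriorKernel (hi : Integrable h μ.fst) :
    Integrable (fun y => ∫ x, h x ∂posteriorKernel μ y) μ.snd :=
  Integrable.integral_compProd (κ := Kernel.const Unit μ.snd)
    (η := Kernel.prodMkLeft Unit (posteriorKernel μ)) (a := ()) (f := fun w : Y × X => h w.2)
    (integrable_comp_snd_compProd μ hi)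

lemma integral_integral_posteriorKernel (hi : Integrable h μ.fst) :
    ∫ y, ∫ x, h x ∂posteriorKernel μ y ∂μ.snd = ∫ x, h x ∂μ.fst := by
  rw [← Measure.integral_compProd (f := fun w : Y × X => h w.2)
    (integrable_comp_snd_compProd μ hi)]
  have := hi.1
  rw [← map_snd_compProd_posteriorKernel μ] at this
  conv_rhs => rw [← map_snd_compProd_posteriorKernel μ]
  rw [integral_map measurable_snd.aemeasurable this]

lemma sq_integral_le_integral_sq {A : Type*} [MeasurableSpace A] {π : Measure A}
    [IsProbabilityMeasure π] {g : A → ℝ} (hg : MemLp g 2 π) :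
    (∫ a, g a ∂π) ^ 2 ≤ ∫ a, g a ^ 2 ∂π := by
  have h1 := variance_eq_sub hg
  have h2 := variance_nonneg g π
  simp only [Pi.pow_apply] at h1
  linarith

lemma ae_memLp_posteriorKernel (hh : MemLp h 2 μ.fst) :
    ∀ᵐ y ∂μ.snd, MemLp h 2 (posteriorKernel μ y) := by
  filter_upwards [ae_integrable_posteriorKernel μ (hh.integrable one_le_two),
    ae_integrable_posteriorKernel μ hh.integrable_sq] with y h1 h2
  exact (memLp_two_iff_integrable_sq h1.1).2 h2

lemma ae_sq_integral_posteriorKernel_le (hh : MemLp h 2 μ.fst) :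
    ∀ᵐ y ∂μ.snd, (∫ x, h x ∂posteriorKernel μ y) ^ 2 ≤ ∫ x, h x ^ 2 ∂posteriorKernel μ y := by
  filter_upwards [ae_memLp_posteriorKernel μ hh] with y hy
  exact sq_integral_le_integral_sq hy

lemma memLp_integral_posteriorKernel (hh : MemLp h 2 μ.fst) :
    MemLp (fun y => ∫ x, h x ∂posteriorKernel μ y) 2 μ.snd := by
  have h1 := (integrable_integral_posteriorKernel μ (hh.integrable one_le_two)).1
  refine (memLp_two_iff_integrable_sq h1).2 ?_
  refine (integrable_integral_posteriorKernel μ hh.integrable_sq).mono' (h1.pow 2) ?_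
  filter_upwards [ae_sq_integral_posteriorKernel_le μ hh] with y hy
  rwa [Real.norm_eq_abs, abs_of_nonneg (sq_nonneg _)]

/-- Jensen's inequality under each posterior, averaged over `y`. -/
lemma betaDen_le_betaNum (hh : MemLp h 2 μ.fst) : betaDen μ h ≤ betaNum μ h := by
  have := integral_mono_ae (memLp_integral_posteriorKernel μ hh).integrable_sq
    (integrable_integral_posteriorKernel μ hh.integrable_sq)
    (ae_sq_integral_posteriorKernel_le μ hh)
  rw [integral_integral_posteriorKernel μ hh.integrable_sq] at this
  exact sub_le_sub_right this _

lemma betaDen_eq_variance (hh : MemLp h 2 μ.fst) :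
    betaDen μ h = variance (fun y => ∫ x, h x ∂posteriorKernel μ y) μ.snd := by
  rw [variance_eq_sub (memLp_integral_posteriorKernel μ hh),
    integral_integral_posteriorKernel μ (hh.integrable one_le_two)]
  rfl

lemma betaDen_nonneg (hh : MemLp h 2 μ.fst) : 0 ≤ betaDen μ h := by
  rw [betaDen_eq_variance μ hh]
  exact variance_nonneg _ _

lemma one_le_betaZero (hh : IsAdmissible μ h) : 1 ≤ betaZero μ h :=
  (one_le_div hh.2).2 (betaDen_le_betaNum μ hh.1)

/-- If `betaDen` vanished on the indicator of every event `A`, the posterior probability of `A`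
would be a.s. constant, hence equal to its prior probability, and `X`, `Y` would be independent. -/
lemma exists_isAdmissible
    (hdep : ¬ IndepFun (Prod.fst : X × Y → X) (Prod.snd : X × Y → Y) μ) :
    ∃ h : X → ℝ, IsAdmissible μ h := by
  by_contra hne
  push Not at hne
  refine hdep (indepFun_iff_measure_inter_preimage_eq_mul.2 fun A B hA hB => ?_)
  let h : X → ℝ := A.indicator 1
  have hh : MemLp h 2 μ.fst := memLp_indicator_const 2 hA 1 (Or.inr (measure_ne_top _ _))
  have h0 : betaDen μ h = 0 :=
    le_antisymm (not_lt.1 fun hlt => hne h ⟨hh, hlt⟩) (betaDen_nonneg μ hh)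
  have hpost : ∀ y, ∫ x, h x ∂posteriorKernel μ y = (posteriorKernel μ y).real A := fun y =>
    integral_indicator_one hA
  have hae : ∀ᵐ y ∂μ.snd, posteriorKernel μ y A = μ.fst A := by
    rw [betaDen_eq_variance μ hh] at h0
    have h1 := (variance_eq_integral (memLp_integral_posteriorKernel μ hh).1.aemeasurable).symm.trans
      h0
    rw [integral_integral_posteriorKernel μ (hh.integrable one_le_two),
      integral_eq_zero_iff_of_nonneg (fun _ => sq_nonneg _)] at h1
    · filter_upwards [h1] with y hy
      have hy' := pow_eq_zero_iff (two_ne_zero) |>.1 hy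
      rw [hpost, integral_indicator_one hA, sub_eq_zero] at hy'
      exact (ENNReal.toReal_eq_toReal_iff' (measure_ne_top _ _) (measure_ne_top _ _)).1 hy'
    · exact ((memLp_integral_posteriorKernel μ hh).sub (memLp_const _)).integrable_sq
  have hk : Measurable fun w : X × Y => (A ×ˢ B).indicator (1 : X × Y → ℝ≥0∞) w :=
    measurable_one.indicator (hA.prod hB)
  have e1 : μ (Prod.fst ⁻¹' A ∩ Prod.snd ⁻¹' B) =
      ∫⁻ y, B.indicator (fun y => posteriorKernel μ y A) y ∂μ.snd := by
    have := lintegral_posteriorKernel μ hk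
    rw [lintegral_indicator_one (hA.prod hB)] at this
    rw [← Set.prod_eq, ← this]
    refine lintegral_congr fun y => ?_
    by_cases hy : y ∈ B
    · rw [Set.indicator_of_mem hy, ← lintegral_indicator_one hA]
      refine lintegral_congr fun x => ?_
      by_cases hx : x ∈ A <;> simp [hx, hy]
    · simp [hy]
  rw [e1, lintegral_indicator hB, setLIntegral_congr_fun_ae hB (g := fun _ => μ.fst A)
    (hae.mono fun y hy _ => hy), setLIntegral_const, Measure.fst_apply hA, Measure.snd_apply hB]

lemma betaDen_congr {h' : X → ℝ} (e : h =ᵐ[μ.fst] h') : betaDen μ h = betaDen μ h' := by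
  unfold betaDen
  rw [integral_congr_ae e]
  congr 1
  refine integral_congr_ae ?_
  filter_upwards [ae_ae_posteriorKernel μ e] with y hy
  rw [integral_congr_ae hy]

lemma tendsto_betaDen_clip (hh : MemLp h 2 μ.fst) :
    Tendsto (fun n => betaDen μ fun x => clip n (h x)) atTop (𝓝 (betaDen μ h)) := by
  refine Tendsto.sub ?_ ((tendsto_integral_clip (hh.integrable one_le_two)).pow 2)
  refine tendsto_integral_of_dominated_convergence (fun y => ∫ x, h x ^ 2 ∂posteriorKernel μ y)
    (fun n => (memLp_integral_posteriorKernel μ (memLp_clip hh n)).1.pow 2)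
    (integrable_integral_posteriorKernel μ hh.integrable_sq) (fun n => ?_) ?_
  · filter_upwards [ae_sq_integral_posteriorKernel_le μ (memLp_clip hh n),
      ae_memLp_posteriorKernel μ hh, ae_memLp_posteriorKernel μ (memLp_clip hh n)] with y h1 h2 h3
    rw [Real.norm_eq_abs, abs_of_nonneg (sq_nonneg _)]
    refine h1.trans (integral_mono h3.integrable_sq h2.integrable_sq fun x => ?_)
    exact sq_le_sq.2 (abs_clip_le_abs n (h x))
  · filter_upwards [ae_integrable_posteriorKernel μ (hh.integrable one_le_two)] with y hy
    exact (tendsto_integral_clip hy).pow 2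

/-- In the infimum of `β₀` it suffices to consider bounded measurable functions. -/
lemma exists_bounded_isAdmissible {β : ℝ} (hh : IsAdmissible μ h) (hβ : betaZero μ h < β) :
    ∃ h' : X → ℝ, Measurable h' ∧ (∃ C : ℝ, 0 < C ∧ ∀ x, |h' x| ≤ C) ∧ IsAdmissible μ h' ∧
      betaZero μ h' < β := by
  obtain ⟨hL, hpos⟩ := hh
  -- `MemLp` only gives a.e. strong measurability, whereas perturbations must be measurable, so `h`
  -- is replaced by a measurable version before truncation.
  set g := hL.1.mk h
  have e : h =ᵐ[μ.fst] g := hL.1.ae_eq_mk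
  have hgm : Measurable g := hL.1.stronglyMeasurable_mk.measurable
  have hgL : MemLp g 2 μ.fst := (memLp_congr_ae e).1 hL
  rw [betaZero, betaNum_congr μ e, betaDen_congr μ e] at hβ
  rw [betaDen_congr μ e] at hpos
  have t1 := tendsto_betaDen_clip μ hgL
  have t2 := (tendsto_betaNum_clip μ hgL).div t1 hpos.ne'
  obtain ⟨n, hn1, hn2⟩ := ((t1.eventually_const_lt hpos).and (t2.eventually_lt_const hβ)).exists
  exact ⟨fun x => clip n (g x), (measurable_clip n).comp hgm,
    ⟨n + 1, by positivity, fun x => (abs_clip_le n (g x)).trans (by linarith)⟩,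
    ⟨memLp_clip hgL n, hn1⟩, hn2⟩

lemma bddBelow_betaZero : BddBelow (betaZero μ '' {h | IsAdmissible μ h}) := by
  refine ⟨1, ?_⟩
  rintro _ ⟨h, hh, rfl⟩
  exact one_le_betaZero μ hh

/-- The product form also covers functions with vanishing denominator, which the infimum ignores. -/
lemma infBetaZero_mul_betaDen_le (hh : MemLp h 2 μ.fst) :
    infBetaZero μ * betaDen μ h ≤ betaNum μ h := by
  rcases (betaDen_nonneg μ hh).eq_or_lt with h0 | hpos
  · rw [← h0, mul_zero, h0]
    exact betaDen_le_betaNum μ hh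
  · rw [← le_div_iff₀ hpos]
    exact csInf_le (bddBelow_betaZero μ) ⟨h, ⟨hh, hpos⟩, rfl⟩

end BetaProperties


/-! ### Second-order expansion of the objective -/

section SecondVariation

lemma lintegral_ofReal_one_add_mul {A : Type*} [MeasurableSpace A] {π : Measure A}
    [IsProbabilityMeasure π] {g : A → ℝ} {ε : ℝ} (hg : Integrable g π)
    (hp : ∀ a, 0 ≤ 1 + ε * g a) :
    ∫⁻ a, ENNReal.ofReal (1 + ε * g a) ∂π = ENNReal.ofReal (1 + ε * ∫ a, g a ∂π) := by
  have hi : Integrable (fun a => 1 + ε * g a) π := (integrable_const 1).add (hg.const_mul ε)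
  rw [← ofReal_integral_eq_lintegral_ofReal hi (ae_of_all _ hp),
    integral_add (integrable_const 1) (hg.const_mul ε), integral_const_mul]
  simp

variable {X Y Z : Type*} [MeasurableSpace X] [MeasurableSpace Y] [MeasurableSpace Z]
  [StandardBorelSpace X] [Nonempty X] (μ : Measure (X × Y)) [IsProbabilityMeasure μ]
  (ν : Measure Z) [IsProbabilityMeasure ν] {G : X → Z → ℝ}

lemma measurable_integral_posteriorKernel (hG : Measurable (Function.uncurry G)) :
    Measurable (Function.uncurry fun (y : Y) (z : Z) => ∫ x, G x z ∂posteriorKernel μ y) := by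
  have hG' : Measurable fun w : (Y × Z) × X => G w.2 w.1.2 :=
    hG.comp (f := fun w : (Y × Z) × X => (w.2, w.1.2)) (by fun_prop)
  exact (StronglyMeasurable.integral_kernel_prod_right' (κ := (posteriorKernel μ).comap
    (Prod.fst : Y × Z → Y) measurable_fst) hG'.stronglyMeasurable).measurable

variable {M : ℝ} (hG : Measurable (Function.uncurry G)) (hM : 0 < M)
  (hGM : ∀ x z, |G x z| ≤ M) (h0 : ∀ x, ∫ z, G x z ∂ν = 0)

include hG hGM h0 in
lemma integral_integral_posteriorKernel_eq_zero (y : Y) :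
    ∫ z, ∫ x, G x z ∂posteriorKernel μ y ∂ν = 0 := by
  rw [integral_integral_swap]
  · simp [h0]
  · refine integrable_of_abs_le ?_ (fun w : Z × X => hGM w.2 w.1)
    exact hG.comp (f := fun w : Z × X => (w.2, w.1)) (by fun_prop)

include hG hM hGM h0

lemma isMarkovKernel_infoXZ_ne_top_objective_eq (β : ℝ) {ε : ℝ} (hε : |ε| < (2 * M)⁻¹) :
    IsMarkovKernel ((Kernel.const X ν).withDensity fun x z => ENNReal.ofReal (1 + ε * G x z)) ∧
    infoXZ μ ((Kernel.const X ν).withDensity fun x z => ENNReal.ofReal (1 + ε * G x z)) ≠ ∞ ∧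
    objective μ β ((Kernel.const X ν).withDensity fun x z => ENNReal.ofReal (1 + ε * G x z)) =
      ((∫ w, klFun (1 + ε * G w.1 w.2) ∂(μ.fst.prod ν)) -
        ∫ z, klFun (1 + ε * ∫ x, G x z ∂μ.fst) ∂ν) -
      β * ((∫ w, klFun (1 + ε * ∫ x, G x w.2 ∂posteriorKernel μ w.1) ∂(μ.snd.prod ν)) -
        ∫ z, klFun (1 + ε * ∫ x, G x z ∂μ.fst) ∂ν) := by
  have hGx : ∀ x, Measurable (G x) := fun x => hG.comp (f := fun z : Z => (x, z)) (by fun_prop)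
  have hGz : ∀ z, Measurable fun x => G x z :=
    fun z => hG.comp (f := fun x : X => (x, z)) (by fun_prop)
  have hpos : ∀ x z, 0 ≤ 1 + ε * G x z := fun x z => by
    linarith [(abs_le.1 (abs_mul_le_half hM hε (hGM x z))).1]
  have hf : Measurable (Function.uncurry fun (x : X) (z : Z) =>
      ENNReal.ofReal (1 + ε * G x z)) := by
    have hG' : Measurable fun w : X × Z => G w.1 w.2 := hG
    exact (by fun_prop : Measurable fun w : X × Z => ENNReal.ofReal (1 + ε * G w.1 w.2))
  have hM1 := isMarkovKernel_const_withDensity (ν := ν) hf fun x => by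
    rw [lintegral_ofReal_one_add_mul (integrable_of_abs_le (hGx x) (hGM x)) (hpos x), h0]
    simp
  have hκ : ∀ᵐ x ∂μ.fst, ((Kernel.const X ν).withDensity
      fun x z => ENNReal.ofReal (1 + ε * G x z)) x =
      ν.withDensity fun z => ENNReal.ofReal (1 + ε * G x z) :=
    ae_of_all _ fun x => by rw [Kernel.withDensity_apply _ hf, Kernel.const_apply]
  have hY := map_jointLaw_snd μ hf hκ
  have hY' : (fun w : Y × Z => ∫⁻ x, ENNReal.ofReal (1 + ε * G x w.2) ∂posteriorKernel μ w.1) =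
      fun w => ENNReal.ofReal (1 + ε * ∫ x, G x w.2 ∂posteriorKernel μ w.1) := by
    ext w
    exact lintegral_ofReal_one_add_mul (integrable_of_abs_le (hGz w.2) fun x => hGM x w.2) fun x => hpos x w.2
  have mX := mutualInfo_withDensity_one_add μ.fst ν hG hM hGM h0 hε
  have mY := mutualInfo_withDensity_one_add μ.snd ν
    (G := fun y z => ∫ x, G x z ∂posteriorKernel μ y) (measurable_integral_posteriorKernel μ hG)
    hM (fun y z => abs_integral_le_of_abs_le fun x => hGM x z)
    (integral_integral_posteriorKernel_eq_zero μ ν hG hGM h0) hε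
  refine ⟨hM1, ?_, ?_⟩
  · rw [infoXZ, map_jointLaw_fst μ hf hκ]
    exact mX.1
  rw [objective, infoXZ, infoYZ, map_jointLaw_fst μ hf hκ, hY, hY', mX.2, mY.2]
  -- The correction terms for the marginal of `Z` agree in both informations, since posterior means
  -- average to the prior mean.
  congr 3
  refine integral_congr_ae (ae_of_all _ fun z => ?_)
  change klFun (1 + ε * ∫ y, ∫ x, G x z ∂posteriorKernel μ y ∂μ.snd) = _
  rw [integral_integral_posteriorKernel μ (integrable_of_abs_le (hGz z) fun x => hGM x z)]

/-- The expansion of the objective at a trivial representation. -/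
lemma exists_expansion_objective (β : ℝ) :
    ∃ F' : ℝ → ℝ, (∀ᶠ ε in 𝓝 (0 : ℝ), HasDerivAt (fun ε => objective μ β
        ((Kernel.const X ν).withDensity fun x z => ENNReal.ofReal (1 + ε * G x z))) (F' ε) ε) ∧
      HasDerivAt F' (∫ z, (betaNum μ (fun x => G x z) - β * betaDen μ fun x => G x z) ∂ν) 0 ∧
      F' 0 = 0 := by
  have hG' : Measurable fun w : X × Z => G w.1 w.2 := hG
  have hY : Measurable fun w : Y × Z => ∫ x, G x w.2 ∂posteriorKernel μ w.1 :=
    measurable_integral_posteriorKernel μ hG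
  have hYM : ∀ w : Y × Z, |∫ x, G x w.2 ∂posteriorKernel μ w.1| ≤ M :=
    fun w => abs_integral_le_of_abs_le fun x => hGM x w.2
  have hm : Measurable fun z => ∫ x, G x z ∂μ.fst :=
    (StronglyMeasurable.integral_prod_left' (μ := μ.fst) (f := fun w : X × Z => G w.1 w.2)
      hG'.stronglyMeasurable).measurable
  have hmM : ∀ z, |∫ x, G x z ∂μ.fst| ≤ M :=
    fun z => abs_integral_le_of_abs_le fun x => hGM x z
  have hXM : ∀ w : X × Z, |G w.1 w.2| ≤ M := fun w => hGM w.1 w.2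
  refine ⟨fun ε => ((∫ w, G w.1 w.2 * Real.log (1 + ε * G w.1 w.2) ∂(μ.fst.prod ν)) -
      ∫ z, (∫ x, G x z ∂μ.fst) * Real.log (1 + ε * ∫ x, G x z ∂μ.fst) ∂ν) -
    β * ((∫ w, (∫ x, G x w.2 ∂posteriorKernel μ w.1) *
        Real.log (1 + ε * ∫ x, G x w.2 ∂posteriorKernel μ w.1) ∂(μ.snd.prod ν)) -
      ∫ z, (∫ x, G x z ∂μ.fst) * Real.log (1 + ε * ∫ x, G x z ∂μ.fst) ∂ν), ?_, ?_, ?_⟩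
  · have hball : ∀ᶠ ε in 𝓝 (0 : ℝ), |ε| < (2 * M)⁻¹ := by
      have := Metric.ball_mem_nhds (0 : ℝ) (ε := (2 * M)⁻¹) (by positivity)
      filter_upwards [this] with ε hε
      simpa using hε
    filter_upwards [hball.eventually_nhds] with ε hε
    have hε0 := hε.self_of_nhds
    refine HasDerivAt.congr_of_eventuallyEq ?_
      (hε.mono fun δ hδ =>
        (isMarkovKernel_infoXZ_ne_top_objective_eq μ ν hG hM hGM h0 β hδ).2.2)
    have d1 := hasDerivAt_integral_klFun (μ.fst.prod ν) hG' hM hXM hε0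
    have d2 := hasDerivAt_integral_klFun ν hm hM hmM hε0
    have d3 := hasDerivAt_integral_klFun (μ.snd.prod ν) hY hM hYM hε0
    exact (d1.sub d2).sub ((d3.sub d2).const_mul β)
  · have d1 := hasDerivAt_integral_mul_log (μ.fst.prod ν) hG' hM hXM
    have d2 := hasDerivAt_integral_mul_log ν hm hM hmM
    have d3 := hasDerivAt_integral_mul_log (μ.snd.prod ν) hY hM hYM
    have hsq : ∀ {t : ℝ}, |t| ≤ M → |t ^ 2| ≤ M ^ 2 := fun ht => by
      rw [abs_pow]; gcongr
    have i1 : Integrable (fun w : X × Z => G w.1 w.2 ^ 2) (μ.fst.prod ν) :=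
      integrable_of_abs_le (by fun_prop) fun w => hsq (hXM w)
    have i2 : Integrable (fun z => (∫ x, G x z ∂μ.fst) ^ 2) ν :=
      integrable_of_abs_le (by fun_prop) fun z => hsq (hmM z)
    have i3 : Integrable (fun w : Y × Z => (∫ x, G x w.2 ∂posteriorKernel μ w.1) ^ 2)
      (μ.snd.prod ν) := integrable_of_abs_le (by fun_prop) fun w => hsq (hYM w)
    convert! (d1.sub d2).sub ((d3.sub d2).const_mul β) using 1
    -- Integrating over `z` last groups the squares into the two variances of `G(·, z)`.
    rw [integral_prod_symm _ i1, integral_prod_symm _ i3,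
      ← integral_sub i1.integral_prod_right i2, ← integral_sub i3.integral_prod_right i2,
      ← integral_const_mul]
    exact integral_sub (i1.integral_prod_right.sub i2)
      ((i3.integral_prod_right.sub i2).const_mul β)
  · simp

end SecondVariation


/-- The slope of `F'` at `0` forces `F' < 0` just to the right of `0`; the mean value theorem then
makes `F` drop. -/
lemma eventually_lt_of_deriv_neg {F F' : ℝ → ℝ} {d : ℝ}
    (h1 : ∀ᶠ ε in 𝓝 (0 : ℝ), HasDerivAt F (F' ε) ε) (h2 : HasDerivAt F' d 0) (h0 : F' 0 = 0)
    (hd : d < 0) : ∀ᶠ ε in 𝓝[>] (0 : ℝ), F ε < F 0 := by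
  have hs := (hasDerivAt_iff_tendsto_slope.1 h2).eventually_lt_const hd
  rw [eventually_nhdsWithin_iff] at hs
  obtain ⟨δ, hδ, hball⟩ := Metric.eventually_nhds_iff.1 (h1.and hs)
  have hδ' : Set.Ioo (0 : ℝ) δ ∈ 𝓝[>] (0 : ℝ) := Ioo_mem_nhdsGT hδ
  filter_upwards [hδ'] with ε hε
  have hd : ∀ t ∈ Set.Icc 0 ε, dist t 0 < δ := fun t ht => by
    rw [Real.dist_eq, sub_zero, abs_of_nonneg ht.1]
    exact ht.2.trans_lt hε.2
  obtain ⟨c, hc, hslope⟩ := exists_hasDerivAt_eq_slope F F' hε.1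
    (fun t ht => (hball (hd t ht)).1.continuousAt.continuousWithinAt)
    (fun t ht => (hball (hd t (Set.Ioo_subset_Icc_self ht))).1)
  have hneg := (hball (hd c (Set.Ioo_subset_Icc_self hc))).2 hc.1.ne'
  rw [slope_def_field, h0, sub_zero, sub_zero] at hneg
  have hFc : F' c < 0 := by
    by_contra hF
    exact absurd hneg (not_lt.2 (div_nonneg (not_lt.1 hF) hc.1.le))
  rw [hslope, sub_zero, div_lt_iff₀ hε.1, zero_mul] at hFc
  linarith

/-! ### Quadratic homogeneity of the two variances -/

section Scaling

variable {X Y : Type*} [MeasurableSpace X] [MeasurableSpace Y]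

lemma betaNum_mul_const (μ : Measure (X × Y)) (h : X → ℝ) (c : ℝ) :
    betaNum μ (fun x => h x * c) = c ^ 2 * betaNum μ h := by
  simp only [betaNum, mul_pow, integral_mul_const]
  ring

lemma betaDen_mul_const [StandardBorelSpace X] [Nonempty X] (μ : Measure (X × Y))
    [IsFiniteMeasure μ] (h : X → ℝ) (c : ℝ) :
    betaDen μ (fun x => h x * c) = c ^ 2 * betaDen μ h := by
  simp only [betaDen, mul_pow, integral_mul_const]
  ring

end Scaling

/-! ### Perturbations as bounded relative densities -/

section Density

variable {X Z : Type*} [MeasurableSpace X] [MeasurableSpace Z] {lam : Measure Z}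
  {p : Z → ℝ} {h : X → Z → ℝ}

lemma IsNondegenerateDensity.integrable (hp : IsNondegenerateDensity lam p) : Integrable p lam :=
  Integrable.of_integral_ne_zero (by rw [hp.integral_eq_one]; exact one_ne_zero)

lemma IsNondegenerateDensity.isProbabilityMeasure (hp : IsNondegenerateDensity lam p) :
    IsProbabilityMeasure (lam.withDensity fun z => ENNReal.ofReal (p z)) := by
  refine ⟨?_⟩
  rw [withDensity_apply _ .univ, setLIntegral_univ,
    ← ofReal_integral_eq_lintegral_ofReal hp.integrable (ae_of_all _ hp.nonneg),
    hp.integral_eq_one, ENNReal.ofReal_one]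

lemma IsNondegenerateDensity.integral_withDensity (hp : IsNondegenerateDensity lam p)
    (g : Z → ℝ) :
    ∫ z, g z ∂(lam.withDensity fun z => ENNReal.ofReal (p z)) = ∫ z, p z * g z ∂lam := by
  rw [integral_withDensity_eq_integral_toReal_smul hp.measurable.ennreal_ofReal
    (ae_of_all _ fun _ => ENNReal.ofReal_lt_top)]
  refine integral_congr_ae (ae_of_all _ fun z => ?_)
  simp only [smul_eq_mul, ENNReal.toReal_ofReal (hp.nonneg z)]

lemma IsPerturbation.exists_abs_le (hh : IsPerturbation lam p h) :
    ∃ M : ℝ, 0 < M ∧ ∀ x z, |h x z| ≤ M * p z := by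
  obtain ⟨ε, hε, hpos⟩ := hh.nonneg
  refine ⟨ε⁻¹, inv_pos.2 hε, fun x z => ?_⟩
  -- Nonnegativity at both `ε` and `-ε` bounds `|h|` by `ε⁻¹ p`; in particular `h` vanishes where
  -- `p` does, so `h / p` loses nothing there.
  have h1 := hpos ε (abs_of_pos hε).le x z
  have h2 := hpos (-ε) (by rw [abs_neg, abs_of_pos hε]) x z
  rw [inv_mul_eq_div, le_div_iff₀ hε]
  rcases abs_cases (h x z) with ⟨h3, -⟩ | ⟨h3, -⟩ <;> rw [h3] <;> linarith

lemma IsPerturbation.mul_div_cancel (hh : IsPerturbation lam p h) (x : X) (z : Z) :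
    p z * (h x z / p z) = h x z := by
  obtain ⟨M, -, hb⟩ := hh.exists_abs_le
  by_cases hz : p z = 0
  · have := hb x z
    rw [hz, mul_zero] at this
    rw [hz, zero_mul, abs_nonpos_iff.1 this]
  · rw [mul_div_cancel₀ _ hz]

lemma IsPerturbation.exists_abs_div_le (hp : IsNondegenerateDensity lam p)
    (hh : IsPerturbation lam p h) : ∃ M : ℝ, 0 < M ∧ ∀ x z, |h x z / p z| ≤ M := by
  obtain ⟨M, hM, hb⟩ := hh.exists_abs_le
  refine ⟨M, hM, fun x z => ?_⟩
  rw [abs_div, abs_of_nonneg (hp.nonneg z)]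
  exact div_le_of_le_mul₀ (hp.nonneg z) hM.le (hb x z)

lemma IsPerturbation.measurable_div (hp : IsNondegenerateDensity lam p)
    (hh : IsPerturbation lam p h) : Measurable (Function.uncurry fun x z => h x z / p z) :=
  hh.measurable.div (hp.measurable.comp measurable_snd)

lemma IsPerturbation.integral_div (hp : IsNondegenerateDensity lam p)
    (hh : IsPerturbation lam p h) (x : X) :
    ∫ z, h x z / p z ∂(lam.withDensity fun z => ENNReal.ofReal (p z)) = 0 := by
  rw [hp.integral_withDensity, ← hh.integral_eq_zero x]
  exact integral_congr_ae (ae_of_all _ fun z => hh.mul_div_cancel x z)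

lemma IsPerturbation.perturbedEncoder_eq [SFinite lam] (hp : IsNondegenerateDensity lam p)
    (hh : IsPerturbation lam p h) (ε : ℝ) :
    perturbedEncoder lam p h ε =
      (Kernel.const X (lam.withDensity fun z => ENNReal.ofReal (p z))).withDensity
        fun x z => ENNReal.ofReal (1 + ε * (h x z / p z)) := by
  have hpm := hp.measurable
  have hm : Measurable fun w : X × Z => h w.1 w.2 := hh.measurable
  have hprob := hp.isProbabilityMeasure
  have e1 : Measurable (Function.uncurry fun (x : X) (z : Z) =>
      ENNReal.ofReal (p z + ε * h x z)) := by
    exact (by fun_prop : Measurable fun w : X × Z => ENNReal.ofReal (p w.2 + ε * h w.1 w.2))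
  have e2 : Measurable (Function.uncurry fun (x : X) (z : Z) =>
      ENNReal.ofReal (1 + ε * (h x z / p z))) := by
    exact (by fun_prop : Measurable fun w : X × Z =>
      ENNReal.ofReal (1 + ε * (h w.1 w.2 / p w.2)))
  ext x : 1
  have hx : Measurable fun z => ENNReal.ofReal (1 + ε * (h x z / p z)) :=
    e2.comp (f := fun z : Z => (x, z)) (by fun_prop)
  rw [perturbedEncoder, Kernel.withDensity_apply _ e1, Kernel.withDensity_apply _ e2,
    Kernel.const_apply, Kernel.const_apply, ← withDensity_mul _ (by fun_prop) hx]
  congr 1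
  ext z
  rw [Pi.mul_apply, ← ENNReal.ofReal_mul (hp.nonneg z)]
  congr 1
  linear_combination (-ε) * hh.mul_div_cancel x z

/-- A nondegenerate density admits a profile `h₂` whose products with bounded functions are
perturbations. -/
lemma exists_perturbation_profile (hp : IsNondegenerateDensity lam p) :
    ∃ h₂ : Z → ℝ, ∫ z, h₂ z ∂lam = 0 ∧ 0 < ∫ z, h₂ z ^ 2 / p z ∂lam ∧
      ∀ {h : X → ℝ} {C : ℝ}, Measurable h → 0 < C → (∀ x, |h x| ≤ C) →
        IsPerturbation lam p fun x z => h x * h₂ z := by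
  obtain ⟨A, hA, hA0, hA1⟩ := hp.nondegenerate
  set a := ∫ z in A, p z ∂lam with ha
  have hpm := hp.measurable
  have hind : Measurable (A.indicator (1 : Z → ℝ)) := measurable_one.indicator hA
  have hiA : Integrable (fun z => p z * A.indicator (1 : Z → ℝ) z) lam := by
    refine (hp.integrable.indicator hA).congr (ae_of_all _ fun z => ?_)
    by_cases hz : z ∈ A <;> simp [hz]
  have eA : ∫ z, p z * A.indicator (1 : Z → ℝ) z ∂lam = a := by
    rw [ha, ← integral_indicator hA]
    refine integral_congr_ae (ae_of_all _ fun z => ?_)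
    by_cases hz : z ∈ A <;> simp [hz]
  have h0 : ∫ z, p z * (A.indicator (1 : Z → ℝ) z - a) ∂lam = 0 := by
    simp only [mul_sub]
    rw [integral_sub hiA (hp.integrable.mul_const a), eA, integral_mul_const, hp.integral_eq_one,
      one_mul, sub_self]
  -- The centred indicator of `A`, weighted by `p`: its `h₂² / p` integral is the variance `a - a²`,
  -- positive since `0 < a < 1`.
  refine ⟨fun z => p z * (A.indicator (1 : Z → ℝ) z - a), h0, ?_, ?_⟩
  · have e : ∀ z, (p z * (A.indicator (1 : Z → ℝ) z - a)) ^ 2 / p z =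
        p z * A.indicator (1 : Z → ℝ) z * (1 - 2 * a) + p z * a ^ 2 := by
      intro z
      by_cases hz : p z = 0
      · simp [hz]
      · by_cases hzA : z ∈ A
        · simp only [Set.indicator_of_mem hzA, Pi.one_apply]
          field_simp
          ring
        · simp only [Set.indicator_of_notMem hzA]
          field_simp
          ring
    simp only [e]
    rw [integral_add (hiA.mul_const _) (hp.integrable.mul_const _), integral_mul_const,
      integral_mul_const, eA, hp.integral_eq_one]
    nlinarith
  · intro h C hm hC hb
    refine ⟨?_, fun x => ?_, C⁻¹, inv_pos.2 hC, fun ε hε x z => ?_⟩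
    · exact (hm.comp measurable_fst).mul
        ((hpm.mul (hind.sub_const a)).comp measurable_snd)
    · rw [integral_const_mul, h0, mul_zero]
    · have h1 : |A.indicator (1 : Z → ℝ) z - a| ≤ 1 := by
        by_cases hz : z ∈ A
        · simp only [Set.indicator_of_mem hz, Pi.one_apply]
          rw [abs_le]; constructor <;> linarith
        · simp only [Set.indicator_of_notMem hz]
          rw [abs_le]; constructor <;> linarith
      have h2 : |ε * h x * (A.indicator (1 : Z → ℝ) z - a)| ≤ 1 := by
        rw [abs_mul, abs_mul]
        calc |ε| * |h x| * |A.indicator (1 : Z → ℝ) z - a| ≤ C⁻¹ * C * 1 := by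
              gcongr
              exact hb x
          _ = 1 := by rw [inv_mul_cancel₀ hC.ne', one_mul]
      have h3 := (abs_le.1 h2).1
      have : p z + ε * (h x * (p z * (A.indicator (1 : Z → ℝ) z - a))) =
          p z * (1 + ε * h x * (A.indicator (1 : Z → ℝ) z - a)) := by ring
      rw [this]
      exact mul_nonneg (hp.nonneg z) (by linarith)

end Density

/-! ### Sign of the second variation, and learnability -/

section Perturbation

variable {X Y Z : Type*} [MeasurableSpace X] [MeasurableSpace Y] [MeasurableSpace Z]
  [StandardBorelSpace X] [Nonempty X] (μ : Measure (X × Y)) [IsProbabilityMeasure μ]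
  {lam : Measure Z} [SFinite lam] {p : Z → ℝ}

lemma exists_expansion_objective_perturbedEncoder (hp : IsNondegenerateDensity lam p)
    {h : X → Z → ℝ} (hh : IsPerturbation lam p h) (β : ℝ) :
    ∃ F' : ℝ → ℝ, (∀ᶠ ε in 𝓝 (0 : ℝ), HasDerivAt
        (fun ε => objective μ β (perturbedEncoder lam p h ε)) (F' ε) ε) ∧
      HasDerivAt F' (∫ z, (betaNum μ (fun x => h x z / p z) - β * betaDen μ fun x => h x z / p z)
        ∂(lam.withDensity fun z => ENNReal.ofReal (p z))) 0 ∧ F' 0 = 0 := by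
  obtain ⟨M, hM, hb⟩ := hh.exists_abs_div_le hp
  have := hp.isProbabilityMeasure
  simp only [hh.perturbedEncoder_eq hp]
  exact exists_expansion_objective μ _ (hh.measurable_div hp) hM hb (hh.integral_div hp) β

lemma infBetaZero_lt_of_hasNegativeSecondVariation (hp : IsNondegenerateDensity lam p)
    {h : X → Z → ℝ} (hh : IsPerturbation lam p h) {β : ℝ}
    (hneg : HasNegativeSecondVariation μ β lam p h) : infBetaZero μ < β := by
  obtain ⟨v, hv, F₁, hF₁, hF₁'⟩ := hneg
  obtain ⟨F₂, hF₂, hF₂', -⟩ := exists_expansion_objective_perturbedEncoder μ hp hh β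
  -- Derivatives are unique, so the given coefficient must be half the explicit integral.
  have e : F₁ =ᶠ[𝓝 0] F₂ := by
    filter_upwards [hF₁, hF₂] with ε h1 h2 using h1.unique h2
  have huniq := hF₁'.unique (hF₂'.congr_of_eventuallyEq e)
  by_contra hβ
  refine absurd huniq (ne_of_lt (lt_of_lt_of_le (by linarith) (integral_nonneg fun z => ?_)))
  obtain ⟨M, hM, hb⟩ := hh.exists_abs_div_le hp
  have hm : Measurable fun x => h x z / p z :=
    (hh.measurable_div hp).comp (f := fun x : X => (x, z)) (by fun_prop)
  have hL : MemLp (fun x => h x z / p z) 2 μ.fst :=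
    MemLp.of_bound hm.aestronglyMeasurable M (ae_of_all _ fun x => hb x z)
  have h1 := infBetaZero_mul_betaDen_le μ hL
  have h2 := mul_le_mul_of_nonneg_right (not_lt.1 hβ) (betaDen_nonneg μ hL)
  change 0 ≤ _ - _
  linarith

/-- By homogeneity the second derivative factors as `(∫ h₂² / p) * (betaNum - β betaDen)`. The
vanishing of `F' 0` is kept because learnability needs an actual decrease. -/
lemma hasNegativeSecondVariation_mul (hp : IsNondegenerateDensity lam p) {h : X → ℝ} {h₂ : Z → ℝ}
    {β : ℝ} (hadm : IsAdmissible μ h) (hβ : betaZero μ h < β)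
    (hpos : 0 < ∫ z, h₂ z ^ 2 / p z ∂lam) (hh : IsPerturbation lam p fun x z => h x * h₂ z) :
    ∃ F' : ℝ → ℝ, ∃ d < 0, (∀ᶠ ε in 𝓝 (0 : ℝ), HasDerivAt
        (fun ε => objective μ β (perturbedEncoder lam p (fun x z => h x * h₂ z) ε)) (F' ε) ε) ∧
      HasDerivAt F' d 0 ∧ F' 0 = 0 := by
  obtain ⟨F', h1, h2, h0⟩ := exists_expansion_objective_perturbedEncoder μ hp hh β
  refine ⟨F', _, ?_, h1, h2, h0⟩
  have hlt : betaNum μ h - β * betaDen μ h < 0 := by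
    rw [betaZero, div_lt_iff₀ hadm.2] at hβ
    linarith
  have e : ∀ z, betaNum μ (fun x => h x * h₂ z / p z) - β * betaDen μ (fun x => h x * h₂ z / p z) =
      (h₂ z / p z) ^ 2 * (betaNum μ h - β * betaDen μ h) := by
    intro z
    simp only [mul_div_assoc]
    rw [betaNum_mul_const, betaDen_mul_const]
    ring
  simp only [e]
  rw [integral_mul_const, hp.integral_withDensity]
  refine mul_neg_of_pos_of_neg ?_ hlt
  refine lt_of_lt_of_eq hpos (integral_congr_ae (ae_of_all _ fun z => ?_))
  by_cases hz : p z = 0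
  · simp [hz]
  · field_simp

lemma HasNegativeSecondVariation.of_mul (hp : IsNondegenerateDensity lam p) {h : X → ℝ}
    {h₂ : Z → ℝ} {β : ℝ} (hadm : IsAdmissible μ h) (hβ : betaZero μ h < β)
    (hpos : 0 < ∫ z, h₂ z ^ 2 / p z ∂lam) (hh : IsPerturbation lam p fun x z => h x * h₂ z) :
    HasNegativeSecondVariation μ β lam p fun x z => h x * h₂ z := by
  obtain ⟨F', d, hd, h1, h2, -⟩ := hasNegativeSecondVariation_mul μ hp hadm hβ hpos hh
  exact ⟨d / 2, by linarith, F', h1, by rwa [mul_div_cancel₀ _ two_ne_zero]⟩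

lemma exists_isAdmissible_lt_of_infBetaZero_lt (hne : ∃ h : X → ℝ, IsAdmissible μ h) {β : ℝ}
    (hβ : infBetaZero μ < β) : ∃ h : X → ℝ, Measurable h ∧ (∃ C : ℝ, 0 < C ∧ ∀ x, |h x| ≤ C) ∧
      IsAdmissible μ h ∧ betaZero μ h < β := by
  obtain ⟨h₀, hh₀⟩ := hne
  obtain ⟨_, ⟨h, hh, rfl⟩, hlt⟩ :=
    exists_lt_of_csInf_lt (Set.Nonempty.image _ (s := {h | IsAdmissible μ h}) ⟨h₀, hh₀⟩) hβ
  exact exists_bounded_isAdmissible μ hh hlt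

lemma isLearnable_of_infBetaZero_lt (hne : ∃ h : X → ℝ, IsAdmissible μ h) {β : ℝ}
    (hβ : infBetaZero μ < β) : IsLearnable μ β := by
  obtain ⟨h, hm, ⟨C, hC, hb⟩, hadm, hlt⟩ := exists_isAdmissible_lt_of_infBetaZero_lt μ hne hβ
  -- A binary representation suffices: the fair coin is perturbed.
  have hp : IsNondegenerateDensity (Measure.count : Measure Bool) (fun _ => 1 / 2) := by
    refine ⟨measurable_const, fun _ => by norm_num, ?_, {true}, measurableSet_singleton true, ?_⟩
    · rw [integral_count, Fintype.sum_bool]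
      norm_num
    · simp [measureReal_def]
      norm_num
  obtain ⟨h₂, -, hpos, hpert⟩ := exists_perturbation_profile (X := X) hp
  have hh := hpert hm hC hb
  obtain ⟨F', d, hd, h1, h2, h0⟩ := hasNegativeSecondVariation_mul μ hp hadm hlt hpos hh
  have hev := eventually_lt_of_deriv_neg h1 h2 h0 hd
  obtain ⟨M, hM, hMb⟩ := hh.exists_abs_div_le hp
  have hprob := hp.isProbabilityMeasure
  have key := fun {ε : ℝ} (hε : |ε| < (2 * M)⁻¹) =>
    isMarkovKernel_infoXZ_ne_top_objective_eq μ _ (hh.measurable_div hp) hM hMb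
      (hh.integral_div hp) β hε
  simp only [← hh.perturbedEncoder_eq hp] at key
  have hM' : (0 : ℝ) < (2 * M)⁻¹ := by positivity
  obtain ⟨ε, hε, hεlt⟩ := (hev.and (Ioo_mem_nhdsGT hM')).exists
  obtain ⟨k1, k2, -⟩ := key (abs_lt.2 ⟨by linarith [hεlt.1], hεlt.2⟩)
  refine ⟨Bool, _, inferInstance, _, k1, k2, fun ν _ => ?_⟩
  -- At `ε = 0` the objective is `0`, the common value of all trivial encoders.
  obtain ⟨-, -, k3⟩ := key (ε := 0) (by simpa using hM')
  simp only [zero_mul, add_zero, klFun_one, integral_zero, sub_zero, mul_zero] at k3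
  rw [k3] at hε
  refine lt_of_lt_of_eq hε ?_
  rw [objective, infoXZ_const, infoYZ_const]
  simp

end Perturbation

end IB

theorem mainTheorem2 {X Y : Type*} [MeasurableSpace X] [StandardBorelSpace X] [Nonempty X]
    [MeasurableSpace Y] (μ : Measure (X × Y)) [IsProbabilityMeasure μ]
    (hdep : ¬ IndepFun (Prod.fst : X × Y → X) (Prod.snd : X × Y → Y) μ) :
    -- the infimum is over a nonempty family of numbers `≥ 1`
    ((∃ h : X → ℝ, IB.IsAdmissible μ h) ∧
      ∀ h : X → ℝ, IB.IsAdmissible μ h → 1 ≤ IB.betaZero μ h) ∧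
    -- sufficient condition for learnability
    (∀ β : ℝ, IB.infBetaZero μ < β → IB.IsLearnable μ β) ∧
    -- equivalence with the existence of a perturbation with negative second variation
    (∀ (β : ℝ) (Z : Type*) [MeasurableSpace Z] (lam : Measure Z) [SigmaFinite lam] (p : Z → ℝ),
      IB.IsNondegenerateDensity lam p →
      (IB.infBetaZero μ < β ↔
        ∃ h : X → Z → ℝ, IB.IsPerturbation lam p h ∧
          IB.HasNegativeSecondVariation μ β lam p h) ∧
      (IB.infBetaZero μ < β ↔
        ∃ (h : X → ℝ) (h₂ : Z → ℝ), IB.IsAdmissible μ h ∧ IB.betaZero μ h < β ∧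
          ∫ z, h₂ z ∂lam = 0 ∧ 0 < ∫ z, h₂ z ^ 2 / p z ∂lam ∧
          IB.IsPerturbation lam p (fun x z => h x * h₂ z) ∧
          IB.HasNegativeSecondVariation μ β lam p (fun x z => h x * h₂ z)) ∧
      (∀ (h : X → ℝ) (h₂ : Z → ℝ), IB.IsAdmissible μ h → IB.betaZero μ h < β →
        ∫ z, h₂ z ∂lam = 0 → 0 < ∫ z, h₂ z ^ 2 / p z ∂lam →
        IB.IsPerturbation lam p (fun x z => h x * h₂ z) →
        IB.HasNegativeSecondVariation μ β lam p (fun x z => h x * h₂ z))) ∧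
    -- slope of the Pareto frontier at the origin
    (∃ s : ℝ, HasDerivWithinAt (IB.paretoFrontier μ) s (Set.Ici 0) 0 ∧
      (IB.infBetaZero μ)⁻¹ ≤ s) := by
  have hne := IB.exists_isAdmissible μ hdep
  have hone : 1 ≤ IB.infBetaZero μ := by
    obtain ⟨h, hh⟩ := hne
    refine le_csInf ⟨_, h, hh, rfl⟩ ?_
    rintro _ ⟨g, hg, rfl⟩
    exact IB.one_le_betaZero μ hg
  refine ⟨⟨hne, fun h hh => IB.one_le_betaZero μ hh⟩,
    fun β hβ => IB.isLearnable_of_infBetaZero_lt μ hne hβ, fun β Z _ lam _ p hp => ?_, ?_⟩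
  · have hprod : IB.infBetaZero μ < β → ∃ (h : X → ℝ) (h₂ : Z → ℝ), IB.IsAdmissible μ h ∧
        IB.betaZero μ h < β ∧ ∫ z, h₂ z ∂lam = 0 ∧ 0 < ∫ z, h₂ z ^ 2 / p z ∂lam ∧
        IB.IsPerturbation lam p (fun x z => h x * h₂ z) ∧
        IB.HasNegativeSecondVariation μ β lam p (fun x z => h x * h₂ z) := by
      intro hβ
      obtain ⟨h, hm, ⟨C, hC, hb⟩, hadm, hlt⟩ :=
        IB.exists_isAdmissible_lt_of_infBetaZero_lt μ hne hβ
      obtain ⟨h₂, h0, hpos, hpert⟩ := IB.exists_perturbation_profile (X := X) hp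
      exact ⟨h, h₂, hadm, hlt, h0, hpos, hpert hm hC hb,
        IB.HasNegativeSecondVariation.of_mul μ hp hadm hlt hpos (hpert hm hC hb)⟩
    refine ⟨⟨fun hβ => ?_, fun ⟨h, hh, hneg⟩ =>
      IB.infBetaZero_lt_of_hasNegativeSecondVariation μ hp hh hneg⟩,
      ⟨hprod, fun ⟨h, h₂, _, _, _, _, hh, hneg⟩ =>
        IB.infBetaZero_lt_of_hasNegativeSecondVariation μ hp hh hneg⟩,
      fun h h₂ hadm hlt _ hpos hh => IB.HasNegativeSecondVariation.of_mul μ hp hadm hlt hpos hh⟩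
    obtain ⟨h, h₂, -, -, -, -, hh, hneg⟩ := hprod hβ
    exact ⟨_, hh, hneg⟩
  · obtain ⟨s, hs, hle⟩ := IB.exists_hasDerivWithinAt_paretoFrontier μ
    refine ⟨s, hs, ?_⟩
    have hlt : ∀ β, IB.infBetaZero μ < β → β⁻¹ < s := fun β hβ =>
      IB.lt_slope_of_isLearnable μ hle (by linarith) (IB.isLearnable_of_infBetaZero_lt μ hne hβ)
    have hspos : 0 < s := lt_trans (inv_pos.2 (by linarith)) (hlt (IB.infBetaZero μ + 1) (by linarith))
    by_contra hcon
    -- If `s` were below the inverse infimum, `β = s⁻¹` would be learnable and give `s < s`.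
    have := hlt s⁻¹ ((lt_inv_comm₀ hspos (by linarith)).1 (not_le.1 hcon))
    rw [inv_inv] at this
    exact lt_irrefl _ this
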